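/- **Setting.** Write points of $\mathbb{H}^3=\mathbb{R}^2\times(0,\infty)$ as $a=(x,y,z)$, $b=(\tilde x,\tilde y,\tilde z)$. Put $d_E(a,b)=\sqrt{(x-\tilde x)^2+(y-\tilde y)^2}$ and let $$d_{\mathbb{H}^3}(a,b)=\operatorname{acosh}\Big(\frac{d_E(a,b)^2}{2z\tilde z}+\frac12\Big(\frac{z}{\tilde z}+\frac{\tilde z}{z}\Big)\Big)$$ be the hyperbolic distance. Let $B_E(\epsilon,a)$ be the open Euclidean ball in $\mathbb{R}^3$ with centre $(x,y,z\cosh\epsilon)$ and radius $z\sinh\epsilon$; for $\epsilon>0$ it is equal to the open hyperbolic ball with centre $a$ and radius $\epsilon$. Let $\mathcal D\subset(0,\infty)^2$ be Borel and symmetric. Two distinct points $a,b$ of a simple locally finite configuration $\phi\subset\mathbb{H}^3$ are in relation $a\stackrel{\phi,\mathcal D}{\leftrightarrow}b$ (MNNR$_{\mathbb{H}^3,\mathcal D}$) if $b$ is the unique point of $\phi\setminus\{a\}$ that is $d_{\mathbb{H}^3}$-nearest to $a$, $a$ is the unique point of $\phi\setminus\{b\}$ that is $d_{\mathbb{H}^3}$-nearest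 to $b$, and $(z,\tilde z)\in\mathcal D$. Let $\lambda>0$, let $f$ be a probability density on $(0,\infty)$, and let $\Phi$ be an independently marked homogeneous Poisson point process: its locations form a homogeneous Poisson process of density $\lambda$ on $\mathbb{R}^2$ and, given the locations, the marks are i.i.d. with distribution $f(z)\,dz$ on $(0,\infty)$. Put $\Lambda(dx\,dy\,dz)=\lambda\,dx\,dy\,f(z)\,dz$. The two-fold Palm measures $\mathbb{P}^{a,b}$ of $\Phi$ are the disintegration of the two-fold Campbell measure $A\times\Gamma\mapsto\mathbb{E}\big[\#\{(a,b)\in A: a\neq b,\ a,b\in\Phi\}\,\mathbf 1_{\{\Phi\in\Gamma\}}\big]$ with respect to the second factorial moment measure of $\Phi$. **Definition of $F$.** For $s\ge 0$ and $z,\tilde z>0$ with $(s,z)\neq(0,\tilde z)$, let $R=\operatorname{acosh}\big(\frac{s^2}{2z\tilde z}+\frac12(\frac z{\tilde z}+\frac{\tilde z}z)\big)$ and $$d=\sqrt{s^2+(z-\tilde z)^2\cosh^2R},\quad r=z\sinh R,\quad \tilde r=\tilde z\sinh R,\quad c=z\cosh R,\quad \tilde c=\tilde z\cosh R,$$ $$h=\frac{(\tilde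 r-r+d)(r+\tilde r-d)}{2d},\qquad \tilde h=\frac{(r-\tilde r+d)(r+\tilde r-d)}{2d},$$ $$\delta=\frac\pi2-\arcsin\frac{\tilde c-c}{d},\qquad \tilde\delta=\frac\pi2-\arcsin\frac{c-\tilde c}{d},$$ and define $$\begin{aligned}F(s,z,\tilde z)={}&\pi\int_{-r}^{r}f(w+c)(r^2-w^2)\,dw+\pi\int_{-\tilde r}^{\tilde r}f(w+\tilde c)(\tilde r^2-w^2)\,dw\\&-\int_{r-h}^{r}\int_0^{2\pi}\int_0^{\sqrt{r^2-w^2}}f(c+w\cos\delta-\sigma\cos\theta\sin\delta)\,\sigma\,d\sigma\,d\theta\,dw\\&-\int_{\tilde r-\tilde h}^{\tilde r}\int_0^{2\pi}\int_0^{\sqrt{\tilde r^2-w^2}}f(\tilde c+w\cos\tilde\delta-\sigma\cos\theta\sin\tilde\delta)\,\sigma\,d\sigma\,d\theta\,dw .\end{aligned}$$ **Theorem.** (1) For all $a\neq b$ in $\mathbb{H}^3$ with marks $z,\tilde z$, with $R=d_{\mathbb{H}^3}(a,b)$, the integrals defining $F(d_E(a,b),z,\tilde z)$ converge absolutely, the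 balls $B_E(R,a)$ and $B_E(R,b)$ are the open hyperbolic balls of radius $R$ about $a$ and $b$, $F(d_E(a,b),z,\tilde z)\in[0,\infty)$, and $\Lambda\big(B_E(R,a)\cup B_E(R,b)\big)=\lambda F(d_E(a,b),z,\tilde z)$. The function $F$ depends neither on $\lambda$ nor on $\mathcal D$. (2) The two-fold Palm probability that $a$ and $b$ are in MNNR$_{\mathbb{H}^3,\mathcal D}$ is $$\mathbb{P}^{a,b}\big(a\stackrel{\Phi,\mathcal D}{\leftrightarrow}b\big)=e^{-\lambda F(d_E(a,b),z,\tilde z)}\,\mathbf 1_{\{(z,\tilde z)\in\mathcal D\}} .$$ This holds for $\Lambda\otimes\Lambda$-almost all $(a,b)$ for every version of the Palm measures; moreover, taking $\mathbb{P}^{a,b}$ to be the law of $\Phi\cup\{a,b\}$ for all $a,b\in\mathbb{H}^3$ gives a version of the Palm measures, and for this version the formula holds for all $a\neq b$. -/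

import Mathlib

open MeasureTheory ProbabilityTheory Set

noncomputable section

namespace HypMNNR

/-! ### The half-space and its hyperbolic geometry -/

/-- The Euclidean plane. -/
abbrev Plane : Type := EuclideanSpace ℝ (Fin 2)

/-- The half-space `ℝ² × (0, ∞)`. A point `a` has planar position `a.1` and third coordinate
(mark, resources) `a.2 > 0`. Only the topological and measurable structures of the product are
used; distances are the explicit ones below. -/
abbrev H3 : Type := Plane × Ioi (0 : ℝ)

/-- The planar Euclidean distance between the positions of two points. -/
def dE (a b : H3) : ℝ := dist a.1 b.1

/-- The hyperbolic distance between two points with planar distance `s` and marks `z`, `t`. -/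
def hypR (s z t : ℝ) : ℝ :=
  Real.arcosh (s ^ 2 / (2 * z * t) + (z / t + t / z) / 2)

/-- The hyperbolic distance on the half-space. -/
def dH (a b : H3) : ℝ := hypR (dE a b) a.2 b.2

/-- The open hyperbolic ball with centre `a` and radius `ε`. -/
def hypBall (ε : ℝ) (a : H3) : Set H3 := {b | dH a b < ε}

/-- The three-dimensional open Euclidean ball with centre `(x, y, z cosh ε)` and radius
`z sinh ε`, where `a = (x, y, z)`. Since `cosh ε > sinh ε`, the ball lies in the half-space. -/
def eucBall (ε : ℝ) (a : H3) : Set H3 :=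
  {b | dist a.1 b.1 ^ 2 + ((b.2 : ℝ) - a.2 * Real.cosh ε) ^ 2 < (a.2 * Real.sinh ε) ^ 2}

/-- The union of the two Euclidean balls attached to `a` and `b`, with `ε = dH a b`. -/
def unionBalls (a b : H3) : Set H3 := eucBall (dH a b) a ∪ eucBall (dH a b) b

/-! ### Configurations and the mutually nearest neighbour relation -/

/-- Simple locally finite configurations of points of the half-space. -/
def Config : Type := {φ : Set H3 // ∀ K : Set H3, IsCompact K → (φ ∩ K).Finite}

/-- The usual sigma-algebra on configurations, generated by the numbers of points in Borel sets. -/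
instance Config.instMeasurableSpace : MeasurableSpace Config :=
  ⨆ B : {B : Set H3 // MeasurableSet B},
    MeasurableSpace.comap (fun φ : Config => (φ.1 ∩ B.1).encard) inferInstance

/-- Add the two points `a` and `b` to a configuration. -/
def Config.addPair (φ : Config) (a b : H3) : Config :=
  ⟨insert a (insert b φ.1), fun K hK =>
    (((φ.2 K hK).insert b).insert a).subset (by
      rintro x ⟨rfl | rfl | hx, hK⟩
      · exact Or.inl rfl
      · exact Or.inr (Or.inl rfl)
      · exact Or.inr (Or.inr ⟨hx, hK⟩))⟩

/-- `b` is the (unique) nearest neighbour of `a` in `φ`, for the hyperbolic distance: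
the argument of the minimum of `dH a` over `φ \ {a}`. -/
def NNR (φ : Set H3) (a b : H3) : Prop :=
  a ∈ φ ∧ b ∈ φ \ {a} ∧ ∀ c ∈ φ \ {a}, c ≠ b → dH a b < dH a c

/-- Mutually nearest neighbours whose pair of marks lies in the control set `D`. -/
def MNNR (φ : Set H3) (D : Set (ℝ × ℝ)) (a b : H3) : Prop :=
  NNR φ a b ∧ NNR φ b a ∧ ((a.2 : ℝ), (b.2 : ℝ)) ∈ D

/-! ### The marked Poisson point process -/

/-- The mark distribution `f(z) dz` on `(0, ∞)`. -/
def markLaw (f : ℝ → ℝ) : Measure (Ioi (0 : ℝ)) :=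
  ((volume : Measure ℝ).withDensity fun z => ENNReal.ofReal (f z)).comap Subtype.val

/-- The measure `Λ(dx dy dz) = lam dx dy f(z) dz` on the half-space. -/
def intensity (lam : ℝ) (f : ℝ → ℝ) : Measure H3 :=
  (ENNReal.ofReal lam • (volume : Measure Plane)).prod (markLaw f)

/-- A random set of points `Ψ` is a (simple) Poisson point process with intensity measure `μ`:
the number of points in a set of finite measure is Poisson distributed, and the numbers of points
in pairwise disjoint sets are independent. -/
structure IsPoissonProcess {Ω E : Type*} [MeasurableSpace Ω] [MeasurableSpace E]
    (P : Measure Ω) (μ : Measure E) (Ψ : Ω → Set E) : Prop where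
  measurable_count : ∀ B : Set E, MeasurableSet B → Measurable fun ω => (Ψ ω ∩ B).encard
  count_law : ∀ B : Set E, MeasurableSet B → μ B ≠ ⊤ → ∀ k : ℕ,
    P {ω | (Ψ ω ∩ B).encard = k} = poissonMeasure (μ B).toNNReal {k}
  count_indep : ∀ (n : ℕ) (B : Fin n → Set E), (∀ i, MeasurableSet (B i)) →
    Pairwise (fun i j => Disjoint (B i) (B j)) →
      iIndepFun (fun i ω => (Ψ ω ∩ B i).encard) P

/-- `Φ` is an independently marked homogeneous Poisson point process: almost surely its points are
`(X n, Z n)`, where the locations `X n` are distinct and form a homogeneous Poisson process with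
density `lam` on the plane, and the marks `Z n` are independent with common distribution `f(z) dz`,
and independent of the locations. -/
def IsMarkedPPP {Ω : Type*} [MeasurableSpace Ω] (P : Measure Ω) (lam : ℝ) (f : ℝ → ℝ)
    (Φ : Ω → Config) : Prop :=
  ∃ (X : ℕ → Ω → Plane) (Z : ℕ → Ω → Ioi (0 : ℝ)),
    (∀ n, Measurable (X n)) ∧ (∀ n, Measurable (Z n)) ∧
    (∀ᵐ ω ∂P, Function.Injective fun n => X n ω) ∧
    (∀ᵐ ω ∂P, (Φ ω).1 = range fun n => (X n ω, Z n ω)) ∧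
    IsPoissonProcess P (ENNReal.ofReal lam • (volume : Measure Plane))
      (fun ω => range fun n => X n ω) ∧
    (∀ n, P.map (Z n) = markLaw f) ∧
    iIndepFun Z P ∧
    IndepFun (fun ω n => X n ω) (fun ω n => Z n ω) P

/-! ### Two-fold Palm measures -/

/-- The second factorial moment measure of a point process: the expected number of ordered pairs
of distinct points of `Φ` in a set of pairs. -/
def secondFactorialMoment {Ω : Type*} [MeasurableSpace Ω] (P : Measure Ω) (Φ : Ω → Config) :
    Measure (H3 × H3) :=
  P.bind fun ω => Measure.count.restrict (Φ ω).1.offDiag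

/-- `κ` is (a version of) the family of two-fold Palm measures `ℙ^{a,b}` of `Φ`: the
disintegration of the two-fold Campbell measure
`A × Γ ↦ 𝔼[ #{(a, b) ∈ A : a ≠ b points of Φ} ; Φ ∈ Γ ]`
with respect to the second factorial moment measure. -/
structure IsTwoFoldPalm {Ω : Type*} [MeasurableSpace Ω] (P : Measure Ω) (Φ : Ω → Config)
    (κ : Kernel (H3 × H3) Config) : Prop where
  isMarkov : IsMarkovKernel κ
  disintegration : ∀ (A : Set (H3 × H3)) (Γ : Set Config), MeasurableSet A → MeasurableSet Γ →
    ∫⁻ ω in Φ ⁻¹' Γ, Measure.count ((Φ ω).1.offDiag ∩ A) ∂P =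
      ∫⁻ p in A, κ p Γ ∂(secondFactorialMoment P Φ)

/-! ### The explicit function `F` -/

/-- The contribution of a full ball of radius `r` centred at height `c`. -/
def ballTerm (f : ℝ → ℝ) (c r : ℝ) : ℝ :=
  Real.pi * ∫ w in (-r)..r, f (w + c) * (r ^ 2 - w ^ 2)

/-- The contribution of a cap of height `h` of a ball of radius `r` centred at height `c`; the
axis of the cap makes the angle `δ` with the vertical. -/
def capTerm (f : ℝ → ℝ) (c r h δ : ℝ) : ℝ :=
  ∫ w in (r - h)..r, ∫ θ in (0)..(2 * Real.pi), ∫ s in (0)..√(r ^ 2 - w ^ 2),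
    f (c + w * Real.cos δ - s * Real.cos θ * Real.sin δ) * s

/-- Absolute convergence of the integral in `ballTerm`. -/
def BallConverges (f : ℝ → ℝ) (c r : ℝ) : Prop :=
  IntegrableOn (fun w : ℝ => f (w + c) * (r ^ 2 - w ^ 2)) (Ioo (-r) r)

/-- Absolute convergence of the triple integral in `capTerm`, in the variables `(w, θ, s)`. -/
def CapConverges (f : ℝ → ℝ) (c r h δ : ℝ) : Prop :=
  IntegrableOn
    (fun q : ℝ × ℝ × ℝ =>
      f (c + q.1 * Real.cos δ - q.2.2 * Real.cos q.2.1 * Real.sin δ) * q.2.2)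
    {q | q.1 ∈ Ioo (r - h) r ∧ q.2.1 ∈ Ioo 0 (2 * Real.pi) ∧ q.2.2 ∈ Ioo 0 √(r ^ 2 - q.1 ^ 2)}

/-- The Euclidean distance `d` between the centres of the two balls. -/
def centreDist (s z t : ℝ) : ℝ :=
  √(s ^ 2 + (z - t) ^ 2 * Real.cosh (hypR s z t) ^ 2)

/-- The height, in the ball of radius `r`, of its part of the lens cut out by a ball of radius
`r₁` with centre at distance `d`. -/
def capHeight (r r₁ d : ℝ) : ℝ := (r₁ - r + d) * (r + r₁ - d) / (2 * d)

/-- The angle with the vertical of the vector from a centre at height `c` to a centre at height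
`c₁`, at distance `d`. -/
def tilt (c c₁ d : ℝ) : ℝ := Real.pi / 2 - Real.arcsin ((c₁ - c) / d)

/-- The function `F(s, z, t)` of the planar distance `s` and the two marks `z`, `t`. -/
def pairF (f : ℝ → ℝ) (s z t : ℝ) : ℝ :=
  let R := hypR s z t
  let d := centreDist s z t
  let r := z * Real.sinh R
  let r₁ := t * Real.sinh R
  let c := z * Real.cosh R
  let c₁ := t * Real.cosh R
  ballTerm f c r + ballTerm f c₁ r₁
    - capTerm f c r (capHeight r r₁ d) (tilt c c₁ d)
    - capTerm f c₁ r₁ (capHeight r₁ r d) (tilt c₁ c d)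

/-- All the integrals in the definition of `pairF f s z t` converge absolutely. -/
def PairFConverges (f : ℝ → ℝ) (s z t : ℝ) : Prop :=
  let R := hypR s z t
  let d := centreDist s z t
  let r := z * Real.sinh R
  let r₁ := t * Real.sinh R
  let c := z * Real.cosh R
  let c₁ := t * Real.cosh R
  BallConverges f c r ∧ BallConverges f c₁ r₁ ∧
    CapConverges f c r (capHeight r r₁ d) (tilt c c₁ d) ∧
    CapConverges f c₁ r₁ (capHeight r₁ r d) (tilt c₁ c d)

/-- The value `exp(-lam F(dE(a, b), z, t)) 1_{(z, t) ∈ D}`, with `z`, `t` the marks of `a`, `b`. -/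
def pairProb (lam : ℝ) (f : ℝ → ℝ) (D : Set (ℝ × ℝ)) (a b : H3) : ℝ :=
  Real.exp (-(lam * pairF f (dE a b) a.2 b.2)) *
    D.indicator (fun _ => (1 : ℝ)) ((a.2 : ℝ), (b.2 : ℝ))

end HypMNNR

end

/-!
Two parts are independent of each other: the `Λ`-measure of the union of the two balls is computed
by elementary geometry, and the Palm measures are identified by Slivnyak's theorem.

**The measure of the union.** By `cmp_dH` a hyperbolic ball is a Euclidean ball with a raised
centre, so `Λ(B(a) ∪ B(b))` is `lam` times an integral of `f(z)` over a union of two Euclidean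
balls. A single ball is cut into horizontal discs, which gives `ballTerm` (`ballTerm_spec`). The two
spheres meet (`centreDist_bounds`), and their radical plane, a null set, divides the
intersection of the balls into a cap of each ball. In orthonormal coordinates whose first axis joins
the two centres (`frame`) a cap is a solid of revolution, and polar coordinates around the axis give
`capTerm` (`capTerm_spec`). Inclusion and exclusion yields `pairF_spec`. Every integral converges
absolutely because `f` is nonnegative and the balls have finite measure.

**The law of the counts.** The generating functional of the locations,
`𝔼 ∏ u(X n) = exp ∫ (u - 1) dμ`, is computed for simple functions `u` from the definition of a
Poisson process and extended by dominated convergence. Averaging over the independent marks shows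
that the marked process has the generating functional with intensity `Λ`
(`IsPoissonProcess.integral_finprod_marked`). Its values at step functions are the characteristic
functions of the counts in disjoint sets, so these counts are independent Poisson variables
(`IsPoissonProcess.count_marked`). The rest of the argument uses only this property, for sets
contained in one of the slabs `{‖(x, y)‖ < m}`, on which `Λ` is finite (`IsSlabPoisson`).

**Slivnyak's theorem.** For disjoint cells and the event that prescribes all their counts, the
two-point Mecke formula is the identity `n P(N = n) = r P(N = n - 1)` for Poisson variables, used
twice (`IsSlabPoisson.mecke_cell`). These events determine a finite measure on configurations
(`Config.measure_ext`), and rectangles determine a measure on pairs, so the formula holds in general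
(`IsSlabPoisson.mecke`). It says that the second factorial moment measure is `Λ ⊗ Λ` and that
adding `a` and `b` to `Φ` is a version of the Palm measure. The sigma-algebra of configurations is
countably generated, so any other version agrees with it for almost all `(a, b)`.

**The relation.** Once `a` and `b` are added to `Φ`, they are mutually nearest neighbours if and
only if `Φ` has no further point in the union of the two closed hyperbolic balls of radius `dH a b`.
Spheres are null sets of `Λ`, hence this is the void probability `exp(-Λ(B(a) ∪ B(b)))`
(`palm_mnnr`).
-/

namespace HypMNNR

open Filter Topology

/-! ### Hyperbolic distance and Euclidean balls -/

theorem one_le_coshArg (s : ℝ) {z t : ℝ} (hz : 0 < z) (ht : 0 < t) :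
    1 ≤ s ^ 2 / (2 * z * t) + (z / t + t / z) / 2 := by
  have h : s ^ 2 / (2 * z * t) + (z / t + t / z) / 2 - 1
      = (s ^ 2 + (z - t) ^ 2) / (2 * z * t) := by
    field_simp
    ring
  have : 0 ≤ (s ^ 2 + (z - t) ^ 2) / (2 * z * t) := by positivity
  linarith

theorem cosh_hypR (s : ℝ) {z t : ℝ} (hz : 0 < z) (ht : 0 < t) :
    2 * z * t * Real.cosh (hypR s z t) = s ^ 2 + z ^ 2 + t ^ 2 := by
  rw [hypR, Real.cosh_arcosh (one_le_coshArg s hz ht)]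
  field_simp
  ring

theorem hypR_nonneg (s : ℝ) {z t : ℝ} (hz : 0 < z) (ht : 0 < t) : 0 ≤ hypR s z t :=
  Real.arcosh_nonneg (one_le_coshArg s hz ht)

theorem hypR_comm (s z t : ℝ) : hypR s z t = hypR s t z := by
  unfold hypR
  congr 1
  ring

theorem dE_comm (a b : H3) : dE a b = dE b a := dist_comm _ _

theorem dH_comm (a b : H3) : dH a b = dH b a := by
  rw [dH, dH, hypR_comm, dE_comm]

theorem dH_nonneg (a b : H3) : 0 ≤ dH a b := hypR_nonneg _ a.2.2 b.2.2

theorem dE_ne_zero_or {a b : H3} (h : a ≠ b) : dE a b ≠ 0 ∨ (a.2 : ℝ) ≠ b.2 := by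
  by_contra! hc
  exact h (Prod.ext (dist_eq_zero.1 hc.1) (Subtype.ext hc.2))

/-- Comparison of a hyperbolic distance with `ε`, in Euclidean terms. -/
theorem cmp_dH {ε : ℝ} (hε : 0 ≤ ε) (a b : H3) :
    (dH a b < ε ↔ dist a.1 b.1 ^ 2 + ((b.2 : ℝ) - a.2 * Real.cosh ε) ^ 2
      < (a.2 * Real.sinh ε) ^ 2) ∧
    (dH a b ≤ ε ↔ dist a.1 b.1 ^ 2 + ((b.2 : ℝ) - a.2 * Real.cosh ε) ^ 2
      ≤ (a.2 * Real.sinh ε) ^ 2) := by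
  have ha : (0 : ℝ) < a.2 := a.2.2
  have hb : (0 : ℝ) < b.2 := b.2.2
  have h1 := cosh_hypR (dE a b) ha hb
  have h2 := Real.cosh_sq ε
  have key : dist a.1 b.1 ^ 2 + ((b.2 : ℝ) - a.2 * Real.cosh ε) ^ 2 - (a.2 * Real.sinh ε) ^ 2
      = 2 * a.2 * b.2 * (Real.cosh (dH a b) - Real.cosh ε) := by
    rw [show dist a.1 b.1 = dE a b from rfl, dH]
    linear_combination -h1 + (a.2 : ℝ) ^ 2 * h2
  have hab : (0 : ℝ) < 2 * a.2 * b.2 := by positivity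
  have hR := dH_nonneg a b
  have hlt : dH a b < ε ↔ Real.cosh (dH a b) - Real.cosh ε < 0 := by
    rw [sub_neg, Real.cosh_lt_cosh, abs_of_nonneg hR, abs_of_nonneg hε]
  have hle : dH a b ≤ ε ↔ Real.cosh (dH a b) - Real.cosh ε ≤ 0 := by
    rw [sub_nonpos, Real.cosh_le_cosh, abs_of_nonneg hR, abs_of_nonneg hε]
  constructor
  · have hs : ∀ x : ℝ, 2 * a.2 * b.2 * x < 0 ↔ x < 0 := fun x =>
      ⟨fun h => by by_contra! hx; linarith [mul_nonneg hab.le hx], mul_neg_of_pos_of_neg hab⟩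
    rw [hlt, ← hs, ← key, sub_neg]
  · have hs : ∀ x : ℝ, 2 * a.2 * b.2 * x ≤ 0 ↔ x ≤ 0 := fun x =>
      ⟨fun h => by by_contra! hx; linarith [mul_pos hab hx],
        mul_nonpos_of_nonneg_of_nonpos hab.le⟩
    rw [hle, ← hs, ← key, sub_nonpos]

theorem hypBall_eq_eucBall {ε : ℝ} (hε : 0 ≤ ε) (a : H3) : hypBall ε a = eucBall ε a := by
  ext b
  exact (cmp_dH hε a b).1

/-! ### The position of the two balls -/

section Position

variable {s z t : ℝ}

theorem centreDist_sq (s z t : ℝ) : centreDist s z t ^ 2 =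
    s ^ 2 + (z * Real.cosh (hypR s z t) - t * Real.cosh (hypR s z t)) ^ 2 := by
  rw [centreDist, Real.sq_sqrt (by positivity)]
  ring

theorem centreDist_pos (h : s ≠ 0 ∨ z ≠ t) : 0 < centreDist s z t := by
  refine Real.sqrt_pos.2 ?_
  rcases h with h | h
  · have := sq_pos_of_ne_zero h
    positivity
  · have := sq_pos_of_ne_zero (sub_ne_zero.2 h)
    have := Real.cosh_pos (hypR s z t)
    positivity

/-- The two spheres meet: the distance of their centres is at most the sum of the radii and at
least their difference. Both squared comparisons reduce to `1 ≤ cosh R`. -/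
theorem centreDist_bounds (hz : 0 < z) (ht : 0 < t) :
    centreDist s z t ≤ z * Real.sinh (hypR s z t) + t * Real.sinh (hypR s z t) ∧
    |t * Real.sinh (hypR s z t) - z * Real.sinh (hypR s z t)| ≤ centreDist s z t := by
  have h1 := cosh_hypR s hz ht
  have h2 := Real.cosh_sq (hypR s z t)
  have h3 := Real.one_le_cosh (hypR s z t)
  have h4 : 0 ≤ Real.sinh (hypR s z t) := Real.sinh_nonneg_iff.2 (hypR_nonneg s hz ht)
  have h5 := centreDist_sq s z t
  set C := Real.cosh (hypR s z t)
  set S := Real.sinh (hypR s z t)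
  have hzt : 0 < z * t := by positivity
  constructor
  · refine abs_le_of_sq_le_sq' ?_ (by positivity) |>.2
    have : (z * S + t * S) ^ 2 - centreDist s z t ^ 2 = 2 * (z * t) * ((2 * C + 1) * (C - 1)) := by
      rw [h5]
      linear_combination -(z + t) ^ 2 * h2 + h1
    have : 0 ≤ 2 * (z * t) * ((2 * C + 1) * (C - 1)) :=
      mul_nonneg (by positivity) (mul_nonneg (by linarith) (by linarith))
    linarith
  · refine abs_le_of_sq_le_sq ?_ (Real.sqrt_nonneg _)
    have : centreDist s z t ^ 2 - (t * S - z * S) ^ 2 = 2 * (z * t) * (C - 1) := by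
      rw [h5]
      linear_combination (z - t) ^ 2 * h2 - h1
    have : 0 ≤ 2 * (z * t) * (C - 1) := mul_nonneg (by positivity) (by linarith)
    linarith

end Position

theorem capHeight_nonneg {r r₁ d : ℝ} (hd : 0 < d) (h : d ≤ r + r₁) (h' : |r₁ - r| ≤ d) :
    0 ≤ capHeight r r₁ d := by
  have := abs_le.1 h'
  exact div_nonneg (mul_nonneg (by linarith) (by linarith)) (by linarith)

/-! ### The intensity as a measure with density -/

theorem map_markLaw (f : ℝ → ℝ) : (markLaw f).map Subtype.val =
    (volume.restrict (Ioi (0 : ℝ))).withDensity fun z => ENNReal.ofReal (f z) := by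
  rw [markLaw, (MeasurableEmbedding.subtype_coe measurableSet_Ioi).map_comap,
    Subtype.range_coe, restrict_withDensity measurableSet_Ioi]

theorem isProbabilityMeasure_markLaw {f : ℝ → ℝ}
    (h1 : ∫⁻ z in Ioi (0 : ℝ), ENNReal.ofReal (f z) = 1) :
    IsProbabilityMeasure (markLaw f) := by
  constructor
  rw [← preimage_univ (f := Subtype.val), ← Measure.map_apply measurable_subtype_coe .univ,
    map_markLaw f, withDensity_apply _ .univ, Measure.restrict_univ, h1]

/-- The half-space inside `ℝ² × ℝ`. -/
def toSpace (p : H3) : Plane × ℝ := (p.1, p.2)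

theorem measurable_toSpace : Measurable toSpace := by
  unfold toSpace
  fun_prop

/-- The measure `f(z) dx dy dz` on `ℝ² × ℝ`. -/
noncomputable def heightMeasure (f : ℝ → ℝ) : Measure (Plane × ℝ) :=
  ((volume : Measure Plane).prod (volume : Measure ℝ)).withDensity
    fun p => ENNReal.ofReal (f p.2)

theorem heightMeasure_apply {f : ℝ → ℝ} (hf : Measurable f) {T : Set (Plane × ℝ)}
    (hT : MeasurableSet T) :
    heightMeasure f T = ∫⁻ z, ENNReal.ofReal (f z) * volume {x : Plane | (x, z) ∈ T} := by
  have hm : Measurable (T.indicator fun p => ENNReal.ofReal (f p.2)) :=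
    Measurable.indicator (by fun_prop) hT
  rw [heightMeasure, withDensity_apply _ hT, ← lintegral_indicator hT,
    lintegral_prod_symm _ hm.aemeasurable]
  refine lintegral_congr fun z => ?_
  have h : MeasurableSet {x : Plane | (x, z) ∈ T} := measurable_prodMk_right hT
  rw [← lintegral_indicator_const h]
  rfl

theorem intensity_preimage {f : ℝ → ℝ} (hf : Measurable f)
    (h1 : ∫⁻ z in Ioi (0 : ℝ), ENNReal.ofReal (f z) = 1) (lam : ℝ) {T : Set (Plane × ℝ)}
    (hT : MeasurableSet T) (hpos : ∀ p ∈ T, 0 < p.2) :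
    intensity lam f (toSpace ⁻¹' T) = ENNReal.ofReal lam * heightMeasure f T := by
  have := isProbabilityMeasure_markLaw h1
  rw [heightMeasure_apply hf hT, intensity, Measure.prod_smul_left, Measure.smul_apply,
    smul_eq_mul, Measure.prod_apply_symm (measurable_toSpace hT)]
  congr 1
  have hm : Measurable fun z : ℝ => volume {x : Plane | (x, z) ∈ T} :=
    measurable_measure_prodMk_right hT
  have e1 : ∫⁻ y : Ioi (0 : ℝ), volume ((fun x : Plane => (x, y)) ⁻¹' (toSpace ⁻¹' T)) ∂markLaw f
      = ∫⁻ z, volume {x : Plane | (x, z) ∈ T} ∂((markLaw f).map Subtype.val) := by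
    rw [lintegral_map hm measurable_subtype_coe]
    rfl
  rw [e1, map_markLaw f, lintegral_withDensity_eq_lintegral_mul _ (by fun_prop) hm,
    ← lintegral_indicator measurableSet_Ioi]
  refine lintegral_congr fun z => ?_
  by_cases hz : z ∈ Ioi (0 : ℝ)
  · simp [hz]
  · rw [indicator_of_notMem hz]
    have : {x : Plane | (x, z) ∈ T} = ∅ := by
      ext x
      simp only [mem_ofPred_eq, mem_empty_iff_false, iff_false]
      exact fun h => hz (hpos _ h)
    simp [this]

/-- The open ball with centre `(x₀, c)` and radius `|r|` in `ℝ² × ℝ`. -/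
def spaceBall (x₀ : Plane) (c r : ℝ) : Set (Plane × ℝ) :=
  {p | dist x₀ p.1 ^ 2 + (p.2 - c) ^ 2 < r ^ 2}

theorem measurableSet_spaceBall (x₀ : Plane) (c r : ℝ) : MeasurableSet (spaceBall x₀ c r) :=
  measurableSet_lt (by fun_prop) (by fun_prop)

theorem pos_of_mem_spaceBall {x₀ : Plane} {c r : ℝ} (hr : 0 ≤ r) (hrc : r ≤ c) {p : Plane × ℝ}
    (hp : p ∈ spaceBall x₀ c r) : 0 < p.2 := by
  have h : (p.2 - c) ^ 2 < r ^ 2 := lt_of_le_of_lt (by nlinarith [sq_nonneg (dist x₀ p.1)]) hp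
  have := abs_lt_of_sq_lt_sq' h hr
  linarith

theorem heightMeasure_spaceBall_lt_top {f : ℝ → ℝ} (hf : Measurable f)
    (h1 : ∫⁻ z in Ioi (0 : ℝ), ENNReal.ofReal (f z) = 1) (x₀ : Plane) {c r : ℝ}
    (hr : 0 ≤ r) (hrc : r ≤ c) : heightMeasure f (spaceBall x₀ c r) < ⊤ := by
  have hsub : spaceBall x₀ c r ⊆ Metric.ball x₀ (r + 1) ×ˢ Ioi (0 : ℝ) := by
    intro p hp
    refine ⟨?_, pos_of_mem_spaceBall hr hrc hp⟩
    have h : dist x₀ p.1 ^ 2 < r ^ 2 := lt_of_le_of_lt (by nlinarith [sq_nonneg (p.2 - c)]) hp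
    have := abs_lt_of_sq_lt_sq' h hr
    rw [Metric.mem_ball, dist_comm]
    linarith
  refine (measure_mono hsub).trans_lt ?_
  rw [heightMeasure, withDensity_apply _ (measurableSet_ball.prod measurableSet_Ioi),
    ← Measure.prod_restrict]
  have := lintegral_prod_mul (μ := volume.restrict (Metric.ball x₀ (r + 1)))
    (ν := volume.restrict (Ioi (0 : ℝ))) (f := fun _ => 1) (g := fun z => ENNReal.ofReal (f z))
    (by fun_prop) (by fun_prop)
  simp only [one_mul] at this
  rw [this, h1]
  simpa using measure_ball_lt_top (μ := (volume : Measure Plane)) (x := x₀) (r := r + 1)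

/-- The horizontal sections of a ball are discs, of area `π (r ^ 2 - w ^ 2)`. -/
theorem ballTerm_spec {f : ℝ → ℝ} (hf : Measurable f) (hf0 : ∀ z, 0 < z → 0 ≤ f z)
    (h1 : ∫⁻ z in Ioi (0 : ℝ), ENNReal.ofReal (f z) = 1) (x₀ : Plane) {c r : ℝ}
    (hr : 0 ≤ r) (hrc : r ≤ c) :
    BallConverges f c r ∧ 0 ≤ ballTerm f c r ∧
      heightMeasure f (spaceBall x₀ c r) = ENNReal.ofReal (ballTerm f c r) := by
  have hfin := heightMeasure_spaceBall_lt_top hf h1 x₀ hr hrc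
  have hnn : ∀ w ∈ Ioo (-r) r, 0 ≤ f (w + c) * (r ^ 2 - w ^ 2) := by
    intro w hw
    refine mul_nonneg (hf0 _ (by linarith [hw.1])) ?_
    nlinarith [hw.1, hw.2]
  -- The height is `w + c`, with `w` measured from the centre.
  have hlin : heightMeasure f (spaceBall x₀ c r) = ENNReal.ofReal Real.pi *
      ∫⁻ w in Ioo (-r) r, ENNReal.ofReal (f (w + c) * (r ^ 2 - w ^ 2)) := by
    rw [heightMeasure_apply hf (measurableSet_spaceBall _ _ _),
      ← lintegral_const_mul _ (by fun_prop), ← lintegral_indicator measurableSet_Ioo,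
      ← lintegral_add_right_eq_self _ c]
    refine lintegral_congr fun w => ?_
    have hdisc : {x : Plane | (x, w + c) ∈ spaceBall x₀ c r}
        = {x | dist x x₀ ^ 2 < r ^ 2 - w ^ 2} := by
      ext x
      simp only [spaceBall, mem_ofPred_eq, add_sub_cancel_right, dist_comm x₀ x]
      exact lt_sub_iff_add_lt.symm
    rw [hdisc]
    by_cases hw : w ∈ Ioo (-r) r
    · have hw2 : 0 ≤ r ^ 2 - w ^ 2 := by nlinarith [hw.1, hw.2]
      have : {x : Plane | dist x x₀ ^ 2 < r ^ 2 - w ^ 2} = Metric.ball x₀ √(r ^ 2 - w ^ 2) := by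
        ext x
        rw [Metric.mem_ball, Real.lt_sqrt dist_nonneg, mem_ofPred_eq]
      rw [this, EuclideanSpace.volume_ball_fin_two, indicator_of_mem hw,
        ← ENNReal.ofReal_pow (Real.sqrt_nonneg _), Real.sq_sqrt hw2,
        ENNReal.ofReal_mul' hw2]
      ring
    · rw [indicator_of_notMem hw]
      have : {x : Plane | dist x x₀ ^ 2 < r ^ 2 - w ^ 2} = ∅ := by
        ext x
        simp only [mem_ofPred_eq, mem_empty_iff_false, iff_false, not_lt]
        have : r ^ 2 ≤ w ^ 2 := by
          by_contra! hlt
          exact hw (abs_lt_of_sq_lt_sq' hlt hr)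
        nlinarith [sq_nonneg (dist x x₀)]
      simp [this]
  have hlt : ∫⁻ w in Ioo (-r) r, ENNReal.ofReal (f (w + c) * (r ^ 2 - w ^ 2)) < ⊤ := by
    rw [hlin] at hfin
    by_contra hc
    rw [not_lt, top_le_iff] at hc
    rw [hc, ENNReal.mul_top (by simpa using Real.pi_pos)] at hfin
    exact lt_irrefl _ hfin
  have hae : 0 ≤ᵐ[volume.restrict (Ioo (-r) r)] fun w => f (w + c) * (r ^ 2 - w ^ 2) :=
    (ae_restrict_iff' measurableSet_Ioo).2 (.of_forall hnn)
  have hint : BallConverges f c r :=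
    ⟨Measurable.aestronglyMeasurable (by fun_prop), by
      rw [hasFiniteIntegral_iff_ofReal hae]
      exact hlt⟩
  have hterm : ballTerm f c r = Real.pi * ∫ w in Ioo (-r) r, f (w + c) * (r ^ 2 - w ^ 2) := by
    rw [ballTerm, intervalIntegral.integral_of_le (by linarith), integral_Ioc_eq_integral_Ioo]
  refine ⟨hint, ?_, ?_⟩
  · rw [hterm]
    exact mul_nonneg Real.pi_pos.le (setIntegral_nonneg measurableSet_Ioo hnn)
  · rw [hterm, hlin, ENNReal.ofReal_mul Real.pi_pos.le,
      ofReal_integral_eq_lintegral_ofReal hint hae]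

/-! ### Cylindrical coordinates around the axis of a cap -/

/-- The identification of `ℂ` with the Euclidean plane. -/
noncomputable def planeIso : ℂ ≃ₗᵢ[ℝ] Plane := Complex.orthonormalBasisOneI.repr

/-- Orthonormal coordinates `(w, (p, q))` of `ℝ² × ℝ` with origin `(x₀, c)`. The unit complex
numbers `η` and `ε` describe the direction of the `w`-axis: its vertical component is `η.im` and
its horizontal component is `η.re` in the direction `ε`. The `q`-axis is horizontal. -/
noncomputable def frame (x₀ : Plane) (c : ℝ) (η ε : Circle) (v : ℝ × ℝ × ℝ) : Plane × ℝ :=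
  (x₀ + planeIso (ε * ⟨(η * ⟨v.1, v.2.1⟩ : ℂ).re, v.2.2⟩), c + (η * ⟨v.1, v.2.1⟩ : ℂ).im)

theorem measurePreserving_complexRotation (η : Circle) :
    MeasurePreserving (fun v : ℝ × ℝ => (((η * ⟨v.1, v.2⟩ : ℂ).re, (η * ⟨v.1, v.2⟩ : ℂ).im))) :=
  (Complex.volume_preserving_equiv_real_prod.comp
    (rotation η).measurePreserving).comp Complex.volume_preserving_equiv_real_prod.symm

theorem measurePreserving_planeFrame (x₀ : Plane) (ε : Circle) :
    MeasurePreserving (fun v : ℝ × ℝ => x₀ + planeIso (ε * ⟨v.1, v.2⟩)) :=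
  (measurePreserving_add_left volume x₀).comp <|
    (planeIso.measurePreserving.comp (rotation ε).measurePreserving).comp
      Complex.volume_preserving_equiv_real_prod.symm

theorem measurePreserving_frame (x₀ : Plane) (c : ℝ) (η ε : Circle) :
    MeasurePreserving (frame x₀ c η ε) := by
  have g1 : MeasurePreserving (fun v : ℝ × ℝ × ℝ => ((v.1, v.2.1), v.2.2)) :=
    volume_preserving_prodAssoc.symm
  have g2 : MeasurePreserving (fun v : (ℝ × ℝ) × ℝ =>
      (((η * ⟨v.1.1, v.1.2⟩ : ℂ).re, (η * ⟨v.1.1, v.1.2⟩ : ℂ).im), v.2)) :=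
    (measurePreserving_complexRotation η).prod (MeasurePreserving.id (volume : Measure ℝ))
  have g3 : MeasurePreserving (fun v : (ℝ × ℝ) × ℝ => (v.1.1, v.1.2, v.2)) :=
    volume_preserving_prodAssoc
  have g4 : MeasurePreserving (fun v : ℝ × ℝ × ℝ => (v.1, v.2.2, v.2.1)) :=
    (MeasurePreserving.id (volume : Measure ℝ)).prod
      (Measure.measurePreserving_swap (μ := (volume : Measure ℝ)) (ν := (volume : Measure ℝ)))
  have g5 : MeasurePreserving (fun v : (ℝ × ℝ) × ℝ =>
      (x₀ + planeIso (ε * ⟨v.1.1, v.1.2⟩), c + v.2)) :=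
    (measurePreserving_planeFrame x₀ ε).prod (measurePreserving_add_left (volume : Measure ℝ) c)
  have h2 : MeasurePreserving (fun v : ℝ × ℝ × ℝ =>
      (((η * ⟨v.1, v.2.1⟩ : ℂ).re, (η * ⟨v.1, v.2.1⟩ : ℂ).im), v.2.2)) := g2.comp g1
  have h3 : MeasurePreserving (fun v : ℝ × ℝ × ℝ =>
      ((η * ⟨v.1, v.2.1⟩ : ℂ).re, (η * ⟨v.1, v.2.1⟩ : ℂ).im, v.2.2)) := g3.comp h2
  have h4 : MeasurePreserving (fun v : ℝ × ℝ × ℝ =>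
      ((η * ⟨v.1, v.2.1⟩ : ℂ).re, v.2.2, (η * ⟨v.1, v.2.1⟩ : ℂ).im)) := g4.comp h3
  have h5 : MeasurePreserving (fun v : ℝ × ℝ × ℝ =>
      (((η * ⟨v.1, v.2.1⟩ : ℂ).re, v.2.2), (η * ⟨v.1, v.2.1⟩ : ℂ).im)) := g1.comp h4
  have h6 := g5.comp h5
  rw [Function.comp_def] at h6
  unfold frame
  exact h6

/-- `frame` is an isometry for the Euclidean distance of `ℝ² × ℝ`. -/
theorem dist_frame_sq (x₀ : Plane) (c : ℝ) (η ε : Circle) (v u : ℝ × ℝ × ℝ) :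
    dist (frame x₀ c η ε u).1 (frame x₀ c η ε v).1 ^ 2
      + ((frame x₀ c η ε v).2 - (frame x₀ c η ε u).2) ^ 2
      = (v.1 - u.1) ^ 2 + (v.2.1 - u.2.1) ^ 2 + (v.2.2 - u.2.2) ^ 2 := by
  have hη := Circle.normSq_coe η
  have h1 : dist (frame x₀ c η ε u).1 (frame x₀ c η ε v).1 ^ 2
      = ((η * ⟨v.1, v.2.1⟩ : ℂ).re - (η * ⟨u.1, u.2.1⟩ : ℂ).re) ^ 2 + (v.2.2 - u.2.2) ^ 2 := by
    rw [dist_comm, frame, frame, dist_add_left, LinearIsometryEquiv.dist_map, dist_eq_norm,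
      ← mul_sub, norm_mul, Circle.norm_coe, one_mul, ← Complex.normSq_eq_norm_sq,
      Complex.normSq_apply]
    simp only [Complex.sub_re, Complex.sub_im]
    ring
  rw [h1]
  simp only [frame, Complex.mul_re, Complex.mul_im]
  rw [Complex.normSq_apply] at hη
  linear_combination ((v.1 - u.1) ^ 2 + (v.2.1 - u.2.1) ^ 2) * hη

/-- The domain of integration of `capTerm` in the variables `(w, θ, s)`. -/
def capDomain (r h : ℝ) : Set (ℝ × ℝ × ℝ) :=
  {q | q.1 ∈ Ioo (r - h) r ∧ q.2.1 ∈ Ioo 0 (2 * Real.pi) ∧ q.2.2 ∈ Ioo 0 √(r ^ 2 - q.1 ^ 2)}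

theorem measurableSet_capDomain (r h : ℝ) : MeasurableSet (capDomain r h) := by
  unfold capDomain
  simp only [mem_Ioo]
  measurability

/-- Polar coordinates in a disc, with the angle measured from the direction opposite to the
first axis, so that it ranges over `(0, 2π)`. -/
theorem lintegral_disc_eq (g : ℝ → ENNReal) (hg : Measurable g) (ρ : ℝ) :
    ∫⁻ v : ℝ × ℝ, {v : ℝ × ℝ | v.1 ^ 2 + v.2 ^ 2 < ρ}.indicator (fun v => g v.1) v
      = ∫⁻ θ in Ioo 0 (2 * Real.pi), ∫⁻ s in Ioo 0 √ρ,
          ENNReal.ofReal s * g (-(s * Real.cos θ)) := by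
  have hm : Measurable fun v : ℝ × ℝ => (Ioo 0 √ρ).indicator
      (fun s => ENNReal.ofReal s * g (s * Real.cos v.2)) v.1 := by
    have : MeasurableSet {v : ℝ × ℝ | v.1 ∈ Ioo 0 √ρ} := measurable_fst measurableSet_Ioo
    exact Measurable.indicator (f := fun v : ℝ × ℝ => ENNReal.ofReal v.1 * g (v.1 * Real.cos v.2))
      (by fun_prop) this
  rw [← lintegral_comp_polarCoord_symm]
  have e1 : ∫⁻ p in polarCoord.target, ENNReal.ofReal p.1 •
      {v : ℝ × ℝ | v.1 ^ 2 + v.2 ^ 2 < ρ}.indicator (fun v => g v.1) (polarCoord.symm p)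
      = ∫⁻ p in Ioi (0 : ℝ) ×ˢ Ioo (-Real.pi) Real.pi, (Ioo 0 √ρ).indicator
        (fun s => ENNReal.ofReal s * g (s * Real.cos p.2)) p.1 := by
    rw [polarCoord_target]
    refine setLIntegral_congr_fun (measurableSet_Ioi.prod measurableSet_Ioo) fun p hp => ?_
    have hp1 : 0 < p.1 := hp.1
    have hiff : (p.1 * Real.cos p.2) ^ 2 + (p.1 * Real.sin p.2) ^ 2 < ρ ↔ p.1 < √ρ := by
      rw [Real.lt_sqrt hp1.le, ← mul_one (p.1 ^ 2), ← Real.cos_sq_add_sin_sq p.2]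
      ring_nf
    simp only [polarCoord_symm_apply, smul_eq_mul]
    by_cases h : p.1 < √ρ
    · rw [indicator_of_mem (show _ ∈ {v : ℝ × ℝ | v.1 ^ 2 + v.2 ^ 2 < ρ} from hiff.2 h),
        indicator_of_mem (show p.1 ∈ Ioo 0 √ρ from ⟨hp1, h⟩)]
    · rw [indicator_of_notMem (show _ ∉ {v : ℝ × ℝ | v.1 ^ 2 + v.2 ^ 2 < ρ} from
          fun h' => h (hiff.1 h')), indicator_of_notMem (fun h' => h h'.2), mul_zero]
  rw [e1, Measure.volume_eq_prod, ← Measure.prod_restrict, lintegral_prod_symm _ hm.aemeasurable]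
  have e2 : ∀ θ : ℝ, ∫⁻ s in Ioi (0 : ℝ), (Ioo 0 √ρ).indicator
      (fun s => ENNReal.ofReal s * g (s * Real.cos θ)) s
      = ∫⁻ s in Ioo 0 √ρ, ENNReal.ofReal s * g (s * Real.cos θ) := by
    intro θ
    rw [lintegral_indicator measurableSet_Ioo, Measure.restrict_restrict measurableSet_Ioo,
      inter_eq_self_of_subset_left Ioo_subset_Ioi_self]
  simp only [e2]
  rw [← lintegral_indicator measurableSet_Ioo, ← lintegral_indicator measurableSet_Ioo,
    ← lintegral_add_right_eq_self _ (-Real.pi)]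
  refine lintegral_congr fun θ => ?_
  have hiff : θ + -Real.pi ∈ Ioo (-Real.pi) Real.pi ↔ θ ∈ Ioo 0 (2 * Real.pi) := by
    simp only [mem_Ioo]
    constructor <;> rintro ⟨h1, h2⟩ <;> constructor <;> linarith
  by_cases h : θ ∈ Ioo 0 (2 * Real.pi)
  · rw [indicator_of_mem h, indicator_of_mem (hiff.2 h), ← sub_eq_add_neg, Real.cos_sub_pi]
    simp only [mul_neg]
  · rw [indicator_of_notMem h, indicator_of_notMem (fun h' => h (hiff.1 h'))]

/-- The measure of a cap in cylindrical coordinates. -/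
theorem lintegral_cap_eq {f : ℝ → ℝ} (hf : Measurable f) {r : ℝ} (hr : 0 ≤ r) (c h δ : ℝ) :
    ∫⁻ v in {v : ℝ × ℝ × ℝ | v.1 ^ 2 + v.2.1 ^ 2 + v.2.2 ^ 2 < r ^ 2 ∧ r - h < v.1},
        ENNReal.ofReal (f (c + (v.1 * Real.cos δ + v.2.1 * Real.sin δ)))
      = ∫⁻ q in capDomain r h, ENNReal.ofReal
          (f (c + q.1 * Real.cos δ - q.2.2 * Real.cos q.2.1 * Real.sin δ) * q.2.2) := by
  have hS : MeasurableSet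
      {v : ℝ × ℝ × ℝ | v.1 ^ 2 + v.2.1 ^ 2 + v.2.2 ^ 2 < r ^ 2 ∧ r - h < v.1} := by
    have h1 : MeasurableSet {v : ℝ × ℝ × ℝ | v.1 ^ 2 + v.2.1 ^ 2 + v.2.2 ^ 2 < r ^ 2} :=
      measurableSet_lt (by fun_prop) (by fun_prop)
    have h2 : MeasurableSet {v : ℝ × ℝ × ℝ | r - h < v.1} :=
      measurableSet_lt (by fun_prop) (by fun_prop)
    exact h1.inter h2
  have hD := measurableSet_capDomain r h
  rw [← lintegral_indicator hS, ← lintegral_indicator hD]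
  set G : ℝ × ℝ × ℝ → ENNReal := (capDomain r h).indicator fun q => ENNReal.ofReal
    (f (c + q.1 * Real.cos δ - q.2.2 * Real.cos q.2.1 * Real.sin δ) * q.2.2) with hG
  have hGm : Measurable G := Measurable.indicator (by fun_prop) hD
  rw [Measure.volume_eq_prod,
    lintegral_prod _ (Measurable.aemeasurable (Measurable.indicator (by fun_prop) hS)),
    lintegral_prod _ hGm.aemeasurable]
  refine lintegral_congr fun w => ?_
  by_cases hw : w ∈ Ioo (r - h) r
  · have e1 : ∀ v : ℝ × ℝ, {v : ℝ × ℝ × ℝ | v.1 ^ 2 + v.2.1 ^ 2 + v.2.2 ^ 2 < r ^ 2 ∧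
        r - h < v.1}.indicator (fun v : ℝ × ℝ × ℝ =>
          ENNReal.ofReal (f (c + (v.1 * Real.cos δ + v.2.1 * Real.sin δ)))) (w, v)
        = {v : ℝ × ℝ | v.1 ^ 2 + v.2 ^ 2 < r ^ 2 - w ^ 2}.indicator
          (fun v => (fun p => ENNReal.ofReal
            (f (c + (w * Real.cos δ + p * Real.sin δ)))) v.1) v := by
      intro v
      have : ((w, v) ∈ {v : ℝ × ℝ × ℝ | v.1 ^ 2 + v.2.1 ^ 2 + v.2.2 ^ 2 < r ^ 2 ∧ r - h < v.1})
          ↔ v ∈ {v : ℝ × ℝ | v.1 ^ 2 + v.2 ^ 2 < r ^ 2 - w ^ 2} := by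
        simp only [mem_ofPred_eq, hw.1, and_true]
        constructor <;> intro h <;> linarith
      by_cases hv : v ∈ {v : ℝ × ℝ | v.1 ^ 2 + v.2 ^ 2 < r ^ 2 - w ^ 2}
      · rw [indicator_of_mem hv, indicator_of_mem (this.2 hv)]
      · rw [indicator_of_notMem hv, indicator_of_notMem (fun h' => hv (this.1 h'))]
    refine ((lintegral_congr e1).trans (lintegral_disc_eq (fun p => ENNReal.ofReal
      (f (c + (w * Real.cos δ + p * Real.sin δ)))) (by fun_prop) _)).trans ?_
    have hGw : Measurable fun v => G (w, v) := hGm.comp measurable_prodMk_left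
    rw [Measure.volume_eq_prod, lintegral_prod _ hGw.aemeasurable,
      ← lintegral_indicator measurableSet_Ioo]
    refine lintegral_congr fun θ => ?_
    by_cases hθ : θ ∈ Ioo 0 (2 * Real.pi)
    · rw [indicator_of_mem hθ, ← lintegral_indicator measurableSet_Ioo]
      refine lintegral_congr fun s => ?_
      by_cases hs : s ∈ Ioo 0 √(r ^ 2 - w ^ 2)
      · rw [indicator_of_mem hs, hG, indicator_of_mem (show (w, θ, s) ∈ capDomain r h from
          ⟨hw, hθ, hs⟩), mul_comm, ← ENNReal.ofReal_mul']
        · congr 3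
          ring
        · exact hs.1.le
      · rw [indicator_of_notMem hs, hG, indicator_of_notMem (fun h' => hs h'.2.2)]
    · rw [indicator_of_notMem hθ]
      have : ∀ s, G (w, θ, s) = 0 := fun s => indicator_of_notMem (fun h' => hθ h'.2.1) _
      simp only [this, lintegral_zero]
  · have e1 : ∀ v : ℝ × ℝ, {v : ℝ × ℝ × ℝ | v.1 ^ 2 + v.2.1 ^ 2 + v.2.2 ^ 2 < r ^ 2 ∧
        r - h < v.1}.indicator (fun v : ℝ × ℝ × ℝ =>
          ENNReal.ofReal (f (c + (v.1 * Real.cos δ + v.2.1 * Real.sin δ)))) (w, v) = 0 := by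
      intro v
      refine indicator_of_notMem ?_ _
      rintro ⟨h1, h2⟩
      refine hw ⟨h2, lt_of_pow_lt_pow_left₀ 2 hr ?_⟩
      have h1' : w ^ 2 + v.1 ^ 2 + v.2 ^ 2 < r ^ 2 := h1
      nlinarith [sq_nonneg v.1, sq_nonneg v.2]
    have e2 : ∀ v : ℝ × ℝ, G (w, v) = 0 :=
      fun v => indicator_of_notMem (fun h' => hw h'.1) _
    simp only [e1, e2]

/-- On the domain of `capTerm` the argument of `f` is positive: it is the height of a point of
the ball. -/
theorem capArg_pos {c r h δ : ℝ} (hr : 0 ≤ r) (hrc : r ≤ c) {q : ℝ × ℝ × ℝ}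
    (hq : q ∈ capDomain r h) :
    0 < c + q.1 * Real.cos δ - q.2.2 * Real.cos q.2.1 * Real.sin δ := by
  have h1 : q.2.2 ^ 2 < r ^ 2 - q.1 ^ 2 := (Real.lt_sqrt hq.2.2.1.le).1 hq.2.2.2
  have h2 := Real.sin_sq_add_cos_sq δ
  have h3 : (q.2.2 * Real.cos q.2.1) ^ 2 ≤ q.2.2 ^ 2 := by
    rw [mul_pow]
    exact mul_le_of_le_one_right (sq_nonneg _) (Real.cos_sq_le_one _)
  have h4 : (q.1 * Real.cos δ - q.2.2 * Real.cos q.2.1 * Real.sin δ) ^ 2 < r ^ 2 := by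
    have : (q.1 * Real.cos δ - q.2.2 * Real.cos q.2.1 * Real.sin δ) ^ 2
        + (q.1 * Real.sin δ + q.2.2 * Real.cos q.2.1 * Real.cos δ) ^ 2
        = q.1 ^ 2 + (q.2.2 * Real.cos q.2.1) ^ 2 := by
      linear_combination (q.1 ^ 2 + (q.2.2 * Real.cos q.2.1) ^ 2) * h2
    nlinarith [sq_nonneg (q.1 * Real.sin δ + q.2.2 * Real.cos q.2.1 * Real.cos δ)]
  have := abs_lt_of_sq_lt_sq' h4 hr
  linarith

/-- If the integral of `capTerm` converges absolutely then Fubini's theorem identifies the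
iterated integral. -/
theorem capTerm_eq_setIntegral {f : ℝ → ℝ} {c r h δ : ℝ} (hh : 0 ≤ h)
    (hc : CapConverges f c r h δ) :
    capTerm f c r h δ = ∫ q in capDomain r h,
      f (c + q.1 * Real.cos δ - q.2.2 * Real.cos q.2.1 * Real.sin δ) * q.2.2 := by
  have hD := measurableSet_capDomain r h
  set G : ℝ × ℝ × ℝ → ℝ := (capDomain r h).indicator fun q =>
    f (c + q.1 * Real.cos δ - q.2.2 * Real.cos q.2.1 * Real.sin δ) * q.2.2 with hG
  have hGi : Integrable G (volume.prod volume) := (integrable_indicator_iff hD).2 hc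
  rw [← integral_indicator hD, ← hG, Measure.volume_eq_prod, integral_prod _ hGi, capTerm,
    intervalIntegral.integral_of_le (by linarith), integral_Ioc_eq_integral_Ioo,
    ← integral_indicator measurableSet_Ioo]
  refine integral_congr_ae ?_
  filter_upwards [hGi.prod_right_ae] with w hwi
  by_cases hw : w ∈ Ioo (r - h) r
  · rw [indicator_of_mem hw, Measure.volume_eq_prod, integral_prod _ hwi,
      intervalIntegral.integral_of_le (by positivity), integral_Ioc_eq_integral_Ioo,
      ← integral_indicator measurableSet_Ioo]
    refine integral_congr_ae (.of_forall fun θ => ?_)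
    by_cases hθ : θ ∈ Ioo 0 (2 * Real.pi)
    · simp only [indicator_of_mem hθ]
      rw [intervalIntegral.integral_of_le (Real.sqrt_nonneg _), integral_Ioc_eq_integral_Ioo,
        ← integral_indicator measurableSet_Ioo]
      refine integral_congr_ae (.of_forall fun s => ?_)
      by_cases hs : s ∈ Ioo 0 √(r ^ 2 - w ^ 2)
      · simp only [indicator_of_mem hs]
        rw [hG, indicator_of_mem (show (w, θ, s) ∈ capDomain r h from ⟨hw, hθ, hs⟩)]
      · simp only [indicator_of_notMem hs]
        rw [hG, indicator_of_notMem (fun h' => hs h'.2.2)]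
    · simp only [indicator_of_notMem hθ]
      have : ∀ s, G (w, θ, s) = 0 := fun s => indicator_of_notMem (fun h' => hθ h'.2.1) _
      simp [this]
  · rw [indicator_of_notMem hw]
    have : ∀ v, G (w, v) = 0 := fun s => indicator_of_notMem (fun h' => hw h'.1) _
    simp [this]

/-! ### The measure of a cap and of the union of two balls -/

/-- Coordinates whose first axis points from `(x₀, c)` to `(x₁, c₁)`. -/
theorem exists_frame (x₀ x₁ : Plane) {c c₁ d : ℝ} (hd : 0 < d)
    (hdd : d ^ 2 = dist x₀ x₁ ^ 2 + (c₁ - c) ^ 2) :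
    ∃ η ε : Circle, (η : ℂ).re = Real.sin (tilt c c₁ d) ∧ (η : ℂ).im = Real.cos (tilt c c₁ d) ∧
      frame x₀ c η ε (d, 0, 0) = (x₁, c₁) := by
  have hle := abs_le.1 (abs_le_of_sq_le_sq (show (c₁ - c) ^ 2 ≤ d ^ 2 by
    nlinarith [sq_nonneg (dist x₀ x₁)]) hd.le)
  have hcos : Real.cos (tilt c c₁ d) = (c₁ - c) / d := by
    rw [tilt, Real.cos_pi_div_two_sub, Real.sin_arcsin]
    · rw [le_div_iff₀ hd]
      linarith
    · rw [div_le_iff₀ hd]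
      linarith
  have hsin : Real.sin (tilt c c₁ d) = dist x₀ x₁ / d := by
    rw [tilt, Real.sin_pi_div_two_sub, Real.cos_arcsin,
      Real.sqrt_eq_iff_eq_sq _ (by positivity)]
    · field_simp
      linarith
    · rw [sub_nonneg, div_pow, div_le_one (by positivity)]
      nlinarith [sq_nonneg (dist x₀ x₁)]
  have hη : ‖(⟨Real.sin (tilt c c₁ d), Real.cos (tilt c c₁ d)⟩ : ℂ)‖ = 1 := by
    rw [← sq_eq_sq₀ (norm_nonneg _) zero_le_one, ← Complex.normSq_eq_norm_sq,
      Complex.normSq_mk, one_pow, ← Real.sin_sq_add_cos_sq (tilt c c₁ d)]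
    ring
  -- If the centres lie on a vertical line then the horizontal direction is arbitrary.
  obtain ⟨ε, hε⟩ : ∃ ε : Circle, (ε : ℂ) * (dist x₀ x₁ : ℝ) = planeIso.symm (x₁ - x₀) := by
    by_cases h : x₀ = x₁
    · exact ⟨1, by simp [h]⟩
    · have h0 : dist x₀ x₁ ≠ 0 := dist_ne_zero.2 h
      refine ⟨⟨planeIso.symm (x₁ - x₀) / (dist x₀ x₁ : ℝ), mem_sphere_zero_iff_norm.2 ?_⟩, ?_⟩
      · rw [norm_div, LinearIsometryEquiv.norm_map, ← dist_eq_norm, Complex.norm_real,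
          Real.norm_of_nonneg dist_nonneg, dist_comm, div_self h0]
      · exact div_mul_cancel₀ _ (Complex.ofReal_ne_zero.2 h0)
  refine ⟨⟨_, mem_sphere_zero_iff_norm.2 hη⟩, ε, rfl, rfl, ?_⟩
  have e1 : ((⟨Real.sin (tilt c c₁ d), Real.cos (tilt c c₁ d)⟩ : ℂ) * ⟨d, 0⟩).re
      = dist x₀ x₁ := by
    simp [Complex.mul_re, hsin, hd.ne']
  have e2 : ((⟨Real.sin (tilt c c₁ d), Real.cos (tilt c c₁ d)⟩ : ℂ) * ⟨d, 0⟩).im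
      = c₁ - c := by
    simp [Complex.mul_im, hcos, hd.ne']
  have e3 : (⟨dist x₀ x₁, 0⟩ : ℂ) = ((dist x₀ x₁ : ℝ) : ℂ) := rfl
  change (x₀ + planeIso (ε * ⟨((⟨Real.sin (tilt c c₁ d), Real.cos (tilt c c₁ d)⟩ : ℂ)
    * ⟨d, 0⟩).re, 0⟩), c + ((⟨Real.sin (tilt c c₁ d), Real.cos (tilt c c₁ d)⟩ : ℂ)
    * ⟨d, 0⟩).im) = _
  rw [e1, e2, e3, hε]
  simp

/-- The power of a point with respect to a sphere in `ℝ² × ℝ`. -/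
noncomputable def spherePower (x₀ : Plane) (c r : ℝ) (p : Plane × ℝ) : ℝ :=
  dist x₀ p.1 ^ 2 + (p.2 - c) ^ 2 - r ^ 2

theorem measurable_spherePower (x₀ : Plane) (c r : ℝ) : Measurable (spherePower x₀ c r) := by
  unfold spherePower
  fun_prop

theorem mem_spaceBall_iff {x₀ : Plane} {c r : ℝ} {p : Plane × ℝ} :
    p ∈ spaceBall x₀ c r ↔ spherePower x₀ c r p < 0 := by
  rw [spherePower, sub_neg]
  rfl

section Frame

variable {x₀ x₁ : Plane} {c c₁ d : ℝ} {η ε : Circle}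

theorem spherePower_frame (r : ℝ) (v : ℝ × ℝ × ℝ) :
    spherePower x₀ c r (frame x₀ c η ε v) = v.1 ^ 2 + v.2.1 ^ 2 + v.2.2 ^ 2 - r ^ 2 := by
  have h := dist_frame_sq x₀ c η ε v (0, 0, 0)
  have h0 : frame x₀ c η ε (0, 0, 0) = (x₀, c) := by
    have : (⟨0, 0⟩ : ℂ) = 0 := rfl
    simp [frame, this]
  rw [h0] at h
  rw [spherePower, h]
  ring

theorem spherePower_frame_sub (h1 : frame x₀ c η ε (d, 0, 0) = (x₁, c₁)) (hd : 0 < d)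
    (r r₁ : ℝ) (v : ℝ × ℝ × ℝ) :
    spherePower x₀ c r (frame x₀ c η ε v) - spherePower x₁ c₁ r₁ (frame x₀ c η ε v)
      = 2 * d * (v.1 - (r - capHeight r r₁ d)) := by
  have h := dist_frame_sq x₀ c η ε v (d, 0, 0)
  rw [h1] at h
  rw [spherePower_frame, spherePower, h, capHeight]
  field_simp
  ring

end Frame

/-- The radical plane of two spheres with different centres is a null set. -/
theorem volume_radicalPlane {x₀ x₁ : Plane} {c c₁ d : ℝ} (hd : 0 < d)
    (hdd : d ^ 2 = dist x₀ x₁ ^ 2 + (c₁ - c) ^ 2) (r r₁ : ℝ) :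
    (volume.prod volume) {p | spherePower x₀ c r p = spherePower x₁ c₁ r₁ p} = 0 := by
  obtain ⟨η, ε, -, -, h1⟩ := exists_frame x₀ x₁ hd hdd
  have hm : MeasurableSet {p | spherePower x₀ c r p = spherePower x₁ c₁ r₁ p} :=
    measurableSet_eq_fun (measurable_spherePower _ _ _) (measurable_spherePower _ _ _)
  have hpre := (measurePreserving_frame x₀ c η ε).measure_preimage hm.nullMeasurableSet
  rw [← Measure.volume_eq_prod, ← hpre]
  have : frame x₀ c η ε ⁻¹' {p | spherePower x₀ c r p = spherePower x₁ c₁ r₁ p}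
      ⊆ {r - capHeight r r₁ d} ×ˢ univ := by
    intro v hv
    have h := spherePower_frame_sub h1 hd r r₁ v
    rw [sub_eq_zero.2 hv] at h
    have h2 : v.1 - (r - capHeight r r₁ d) = 0 := by
      rcases mul_eq_zero.1 h.symm with h' | h'
      · linarith
      · exact h'
    exact ⟨sub_eq_zero.1 h2, mem_univ _⟩
  refine measure_mono_null this ?_
  rw [Measure.volume_eq_prod, Measure.prod_prod, Real.volume_singleton, zero_mul]

/-- The part of a ball on the far side of the radical plane of the two spheres. -/
def capSet (x₀ : Plane) (c r : ℝ) (x₁ : Plane) (c₁ r₁ : ℝ) : Set (Plane × ℝ) :=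
  {p | spherePower x₀ c r p < 0 ∧ spherePower x₁ c₁ r₁ p < spherePower x₀ c r p}

theorem measurableSet_capSet (x₀ : Plane) (c r : ℝ) (x₁ : Plane) (c₁ r₁ : ℝ) :
    MeasurableSet (capSet x₀ c r x₁ c₁ r₁) :=
  (measurableSet_lt (measurable_spherePower x₀ c r) measurable_const).inter
    (measurableSet_lt (measurable_spherePower x₁ c₁ r₁) (measurable_spherePower x₀ c r))

theorem capTerm_spec {f : ℝ → ℝ} (hf : Measurable f) (hf0 : ∀ z, 0 < z → 0 ≤ f z)
    (h1 : ∫⁻ z in Ioi (0 : ℝ), ENNReal.ofReal (f z) = 1) {x₀ x₁ : Plane} {c c₁ r r₁ d : ℝ}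
    (hr : 0 ≤ r) (hrc : r ≤ c) (hd : 0 < d) (hdd : d ^ 2 = dist x₀ x₁ ^ 2 + (c₁ - c) ^ 2)
    (hh : 0 ≤ capHeight r r₁ d) :
    CapConverges f c r (capHeight r r₁ d) (tilt c c₁ d) ∧
      0 ≤ capTerm f c r (capHeight r r₁ d) (tilt c c₁ d) ∧
      heightMeasure f (capSet x₀ c r x₁ c₁ r₁)
        = ENNReal.ofReal (capTerm f c r (capHeight r r₁ d) (tilt c c₁ d)) := by
  obtain ⟨η, ε, hre, him, hfr⟩ := exists_frame x₀ x₁ hd hdd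
  set δ := tilt c c₁ d
  set h := capHeight r r₁ d with hh_def
  have hcap := measurableSet_capSet x₀ c r x₁ c₁ r₁
  have hpre : frame x₀ c η ε ⁻¹' capSet x₀ c r x₁ c₁ r₁
      = {v : ℝ × ℝ × ℝ | v.1 ^ 2 + v.2.1 ^ 2 + v.2.2 ^ 2 < r ^ 2 ∧ r - h < v.1} := by
    ext v
    have e := spherePower_frame_sub hfr hd r r₁ v
    have e' := spherePower_frame (x₀ := x₀) (c := c) (η := η) (ε := ε) r v
    have hs : 0 < 2 * d * (v.1 - (r - h)) ↔ r - h < v.1 := by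
      rw [mul_pos_iff_of_pos_left (by positivity), sub_pos]
    change spherePower x₀ c r _ < 0 ∧ spherePower x₁ c₁ r₁ _ < spherePower x₀ c r _ ↔ _ ∧ _
    rw [← sub_pos (b := spherePower x₁ c₁ r₁ _), e, hs, e', sub_neg]
  have hlin : heightMeasure f (capSet x₀ c r x₁ c₁ r₁) = ∫⁻ q in capDomain r h, ENNReal.ofReal
      (f (c + q.1 * Real.cos δ - q.2.2 * Real.cos q.2.1 * Real.sin δ) * q.2.2) := by
    rw [← lintegral_cap_eq hf hr, heightMeasure, withDensity_apply _ hcap,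
      ← Measure.volume_eq_prod,
      ← (measurePreserving_frame x₀ c η ε).setLIntegral_comp_preimage hcap (by fun_prop), hpre]
    refine lintegral_congr fun v => ?_
    simp only [frame, Complex.mul_im, hre, him]
    congr 3
    ring
  have hnn : ∀ q ∈ capDomain r h,
      0 ≤ f (c + q.1 * Real.cos δ - q.2.2 * Real.cos q.2.1 * Real.sin δ) * q.2.2 :=
    fun q hq => mul_nonneg (hf0 _ (capArg_pos hr hrc hq)) hq.2.2.1.le
  have hlt : heightMeasure f (capSet x₀ c r x₁ c₁ r₁) < ⊤ :=
    (measure_mono fun p hp => mem_spaceBall_iff.2 hp.1).trans_lt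
      (heightMeasure_spaceBall_lt_top hf h1 x₀ hr hrc)
  have hae : 0 ≤ᵐ[volume.restrict (capDomain r h)] fun q : ℝ × ℝ × ℝ =>
      f (c + q.1 * Real.cos δ - q.2.2 * Real.cos q.2.1 * Real.sin δ) * q.2.2 :=
    (ae_restrict_iff' (measurableSet_capDomain r h)).2 (.of_forall hnn)
  have hint : CapConverges f c r h δ := by
    rw [hlin] at hlt
    exact ⟨Measurable.aestronglyMeasurable (by fun_prop),
      (hasFiniteIntegral_iff_ofReal hae).2 hlt⟩
  have hterm := capTerm_eq_setIntegral hh hint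
  refine ⟨hint, ?_, ?_⟩
  · rw [hterm]
    exact setIntegral_nonneg (measurableSet_capDomain r h) hnn
  · rw [hlin, hterm]
    exact (ofReal_integral_eq_lintegral_ofReal hint hae).symm

theorem eucBall_eq_preimage (ε : ℝ) (a : H3) : eucBall ε a =
    toSpace ⁻¹' spaceBall a.1 (a.2 * Real.cosh ε) (a.2 * Real.sinh ε) := rfl

/-- Inclusion-exclusion for the two balls. The radical plane of the two spheres divides the
intersection into one cap of each ball. -/
theorem pairF_spec {f : ℝ → ℝ} (hf : Measurable f) (hf0 : ∀ z, 0 < z → 0 ≤ f z)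
    (h1 : ∫⁻ z in Ioi (0 : ℝ), ENNReal.ofReal (f z) = 1) {lam : ℝ} (hlam : 0 < lam)
    {a b : H3} (hab : a ≠ b) :
    PairFConverges f (dE a b) a.2 b.2 ∧ 0 ≤ pairF f (dE a b) a.2 b.2 ∧
      intensity lam f (unionBalls a b) =
        ENNReal.ofReal (lam * pairF f (dE a b) a.2 b.2) := by
  have ha : (0 : ℝ) < a.2 := a.2.2
  have hb : (0 : ℝ) < b.2 := b.2.2
  have hne := dE_ne_zero_or hab
  have hd := centreDist_pos hne
  obtain ⟨hb1, hb2⟩ := centreDist_bounds (s := dE a b) ha hb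
  have hdd := centreDist_sq (dE a b) a.2 b.2
  have hS : 0 ≤ Real.sinh (hypR (dE a b) a.2 b.2) :=
    Real.sinh_nonneg_iff.2 (hypR_nonneg _ ha hb)
  have hSC := (Real.sinh_lt_cosh (hypR (dE a b) a.2 b.2)).le
  rw [unionBalls, eucBall_eq_preimage, eucBall_eq_preimage, ← preimage_union]
  simp only [PairFConverges, pairF, dH]
  set R := hypR (dE a b) a.2 b.2
  set d := centreDist (dE a b) a.2 b.2
  have hr : 0 ≤ a.2 * Real.sinh R := mul_nonneg ha.le hS
  have hr₁ : 0 ≤ b.2 * Real.sinh R := mul_nonneg hb.le hS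
  have hrc : a.2 * Real.sinh R ≤ a.2 * Real.cosh R := mul_le_mul_of_nonneg_left hSC ha.le
  have hrc₁ : b.2 * Real.sinh R ≤ b.2 * Real.cosh R := mul_le_mul_of_nonneg_left hSC hb.le
  set r := a.2 * Real.sinh R
  set r₁ := b.2 * Real.sinh R
  set c := a.2 * Real.cosh R
  set c₁ := b.2 * Real.cosh R
  have hdd1 : d ^ 2 = dist a.1 b.1 ^ 2 + (c₁ - c) ^ 2 := by
    rw [hdd, dE]
    ring
  have hdd2 : d ^ 2 = dist b.1 a.1 ^ 2 + (c - c₁) ^ 2 := by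
    rw [hdd, dE, dist_comm]
  obtain ⟨B1, B1n, B1e⟩ := ballTerm_spec hf hf0 h1 a.1 hr hrc
  obtain ⟨B2, B2n, B2e⟩ := ballTerm_spec hf hf0 h1 b.1 hr₁ hrc₁
  obtain ⟨C1, C1n, C1e⟩ := capTerm_spec hf hf0 h1 hr hrc hd hdd1
    (capHeight_nonneg hd hb1 hb2)
  obtain ⟨C2, C2n, C2e⟩ := capTerm_spec hf hf0 h1 hr₁ hrc₁ hd hdd2
    (capHeight_nonneg hd (hb1.trans_eq (add_comm _ _)) (by rwa [abs_sub_comm]))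
  have hfin1 := heightMeasure_spaceBall_lt_top hf h1 a.1 hr hrc
  have hm1 := measurableSet_spaceBall a.1 c r
  have hm2 := measurableSet_spaceBall b.1 c₁ r₁
  have hinter : heightMeasure f (spaceBall a.1 c r ∩ spaceBall b.1 c₁ r₁)
      = heightMeasure f (capSet a.1 c r b.1 c₁ r₁)
        + heightMeasure f (capSet b.1 c₁ r₁ a.1 c r) := by
    rw [← measure_union _ (measurableSet_capSet _ _ _ _ _ _)]
    · have hnull : heightMeasure f
          {p | spherePower a.1 c r p = spherePower b.1 c₁ r₁ p} = 0 :=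
        withDensity_absolutelyContinuous _ _ (volume_radicalPlane hd hdd1 r r₁)
      refine measure_congr ?_
      filter_upwards [compl_mem_ae_iff.2 hnull] with p hp
      have hp' : spherePower a.1 c r p ≠ spherePower b.1 c₁ r₁ p := hp
      refine propext ?_
      change (p ∈ spaceBall a.1 c r ∧ p ∈ spaceBall b.1 c₁ r₁) ↔
        ((spherePower a.1 c r p < 0 ∧ spherePower b.1 c₁ r₁ p < spherePower a.1 c r p) ∨
        (spherePower b.1 c₁ r₁ p < 0 ∧ spherePower a.1 c r p < spherePower b.1 c₁ r₁ p))
      rw [mem_spaceBall_iff, mem_spaceBall_iff]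
      constructor
      · rintro ⟨h, h'⟩
        rcases lt_or_gt_of_ne hp' with hlt | hlt
        · exact Or.inr ⟨h', hlt⟩
        · exact Or.inl ⟨h, hlt⟩
      · rintro (⟨h, h'⟩ | ⟨h, h'⟩)
        · exact ⟨h, h'.trans h⟩
        · exact ⟨h'.trans h, h⟩
    · rw [Set.disjoint_left]
      rintro p ⟨-, h⟩ ⟨-, h'⟩
      exact lt_asymm h h'
  have hU := measure_union_add_inter (μ := heightMeasure f) (spaceBall a.1 c r) hm2
  rw [hinter, B1e, B2e, C1e, C2e, ← ENNReal.ofReal_add C1n C2n,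
    ← ENNReal.ofReal_add B1n B2n] at hU
  have hle : capTerm f c r (capHeight r r₁ d) (tilt c c₁ d)
      + capTerm f c₁ r₁ (capHeight r₁ r d) (tilt c₁ c d) ≤ ballTerm f c r + ballTerm f c₁ r₁ := by
    rw [← ENNReal.ofReal_le_ofReal_iff (by positivity), ← hU]
    exact le_add_self
  refine ⟨⟨B1, B2, C1, C2⟩, by linarith, ?_⟩
  rw [intensity_preimage hf h1 _ (hm1.union hm2), ENNReal.ofReal_mul hlam.le]
  · congr 1
    rw [sub_sub, ENNReal.ofReal_sub _ (by positivity), ← hU,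
      ENNReal.add_sub_cancel_right ENNReal.ofReal_ne_top]
  · rintro p (hp | hp)
    · exact pos_of_mem_spaceBall hr hrc hp
    · exact pos_of_mem_spaceBall hr₁ hrc₁ hp

/-! ### Step functions with values in the complex numbers -/

open scoped Classical in
/-- The function equal to `c i` on `B i`, for disjoint sets `B i`, and to `1` elsewhere. -/
noncomputable def stepFun {ι E : Type*} [Fintype ι] (B : ι → Set E) (c : ι → ℂ) (x : E) : ℂ :=
  ∏ i, if x ∈ B i then c i else 1

section Step

variable {ι E : Type*} [Fintype ι] {B : ι → Set E}

theorem stepFun_of_mem (hB : Pairwise fun i j => Disjoint (B i) (B j)) (c : ι → ℂ) {i : ι}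
    {x : E} (hx : x ∈ B i) : stepFun B c x = c i := by
  classical
  rw [stepFun, Finset.prod_eq_single i]
  · simp [hx]
  · intro j _ hj
    rw [if_neg (fun h => (hB hj).le_bot ⟨h, hx⟩)]
  · simp

theorem stepFun_of_notMem (c : ι → ℂ) {x : E} (hx : ∀ i, x ∉ B i) : stepFun B c x = 1 :=
  Finset.prod_eq_one fun i _ => if_neg (hx i)

theorem stepFun_sub_one (hB : Pairwise fun i j => Disjoint (B i) (B j)) (c : ι → ℂ) (x : E) :
    stepFun B c x - 1 = ∑ i, (B i).indicator (fun _ => c i - 1) x := by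
  by_cases h : ∃ i, x ∈ B i
  · obtain ⟨i, hi⟩ := h
    rw [stepFun_of_mem hB c hi, Finset.sum_eq_single i]
    · rw [indicator_of_mem hi]
    · intro j _ hj
      rw [indicator_of_notMem (fun h => (hB hj).le_bot ⟨h, hi⟩)]
    · simp
  · push Not at h
    rw [stepFun_of_notMem c h, sub_self, Finset.sum_eq_zero]
    exact fun i _ => indicator_of_notMem (h i) _

theorem measurable_stepFun [MeasurableSpace E] (hB : ∀ i, MeasurableSet (B i)) (c : ι → ℂ) :
    Measurable (stepFun B c) :=
  Finset.measurable_prod _ fun i _ => Measurable.ite (hB i) measurable_const measurable_const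

theorem norm_stepFun_le {c : ι → ℂ} (hc : ∀ i, ‖c i‖ ≤ 1) (x : E) : ‖stepFun B c x‖ ≤ 1 := by
  rw [stepFun, norm_prod]
  refine Finset.prod_le_one (fun _ _ => norm_nonneg _) fun i _ => ?_
  split_ifs
  · exact hc i
  · simp

theorem setIntegral_stepFun_sub_one [MeasurableSpace E] {μ : Measure E} {W : Set E}
    (hW : μ W ≠ ⊤) (hB : Pairwise fun i j => Disjoint (B i) (B j))
    (hm : ∀ i, MeasurableSet (B i)) (hBW : ∀ i, B i ⊆ W) (c : ι → ℂ) :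
    ∫ x in W, (stepFun B c x - 1) ∂μ = ∑ i, ((μ (B i)).toReal : ℂ) * (c i - 1) := by
  have hi : ∀ i, μ (B i) ≠ ⊤ := fun i => ne_top_of_le_ne_top hW (measure_mono (hBW i))
  simp only [stepFun_sub_one hB]
  rw [integral_finsetSum]
  · refine Finset.sum_congr rfl fun i _ => ?_
    rw [integral_indicator_const _ (hm i), measureReal_def, Measure.restrict_apply (hm i),
      inter_eq_self_of_subset_left (hBW i), Complex.real_smul]
  · intro i _
    refine (integrable_indicator_iff (hm i)).2 ?_
    refine integrableOn_const ?_
    rw [Measure.restrict_apply (hm i), inter_eq_self_of_subset_left (hBW i)]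
    exact hi i

end Step

/-! ### Products over the points of a sequence -/

section Points

variable {E : Type*} {y : ℕ → E}

theorem finite_index_of_finite_points (hy : Function.Injective y) {B : Set E}
    (hB : (range y ∩ B).Finite) : {n | y n ∈ B}.Finite := by
  refine Finite.of_finite_image (f := y) (hB.subset ?_) hy.injOn
  rintro _ ⟨n, hn, rfl⟩
  exact ⟨mem_range_self n, hn⟩

theorem encard_range_inter (hy : Function.Injective y) (B : Set E) :
    (range y ∩ B).encard = {n | y n ∈ B}.encard := by
  rw [← hy.encard_image]
  congr 1
  ext x
  constructor
  · rintro ⟨⟨n, rfl⟩, hn⟩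
    exact ⟨n, hn, rfl⟩
  · rintro ⟨n, hn, rfl⟩
    exact ⟨mem_range_self n, hn⟩

theorem mulSupport_subset_of_eq_one {u : E → ℂ} {B : Set E} (hu : ∀ x ∉ B, u x = 1) :
    Function.mulSupport (fun n => u (y n)) ⊆ {n | y n ∈ B} := by
  intro n hn
  by_contra h
  exact hn (hu _ h)

open scoped Classical in
theorem finprod_ite_mem (hy : Function.Injective y) {B : Set E} (hB : (range y ∩ B).Finite)
    (c : ℂ) : ∏ᶠ n, (if y n ∈ B then c else 1) = c ^ (range y ∩ B).encard.toNat := by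
  have hf := finite_index_of_finite_points hy hB
  rw [finprod_eq_prod_of_mulSupport_subset (s := hf.toFinset)]
  · rw [Finset.prod_congr rfl (g := fun _ => c), Finset.prod_const, encard_range_inter hy,
      hf.encard_eq_coe_toFinset_card, ENat.toNat_natCast]
    intro n hn
    rw [if_pos (by simpa using hn)]
  · rw [Finite.coe_toFinset]
    exact mulSupport_subset_of_eq_one (u := fun x => if x ∈ B then c else 1)
      fun x hx => if_neg hx

theorem finprod_stepFun {ι : Type*} [Fintype ι] (hy : Function.Injective y) {B : ι → Set E}
    (hB : ∀ i, (range y ∩ B i).Finite) (c : ι → ℂ) :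
    ∏ᶠ n, stepFun B c (y n) = ∏ i, c i ^ (range y ∩ B i).encard.toNat := by
  classical
  simp only [stepFun]
  rw [finprod_prod_comm]
  · refine Finset.prod_congr rfl fun i _ => ?_
    rw [← finprod_ite_mem hy (hB i) (c i)]
  · intro i _
    exact (finite_index_of_finite_points hy (hB i)).subset
      (mulSupport_subset_of_eq_one (u := fun x => if x ∈ B i then c i else 1)
        fun x hx => if_neg hx)

theorem eventually_prod_eq_finprod (hy : Function.Injective y) {u : E → ℂ} {B : Set E}
    (hB : (range y ∩ B).Finite) (hu : ∀ x ∉ B, u x = 1) :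
    ∀ᶠ M in atTop, ∏ n ∈ Finset.range M, u (y n) = ∏ᶠ n, u (y n) := by
  obtain ⟨M₀, hM₀⟩ := (finite_index_of_finite_points hy hB).bddAbove
  filter_upwards [eventually_gt_atTop M₀] with M hM
  rw [finprod_eq_prod_of_mulSupport_subset]
  intro n hn
  have := hM₀ (mulSupport_subset_of_eq_one hu hn)
  simpa using this.trans_lt hM

theorem norm_finprod_le_one (hy : Function.Injective y) {u : E → ℂ} {B : Set E}
    (hB : (range y ∩ B).Finite) (hu : ∀ x ∉ B, u x = 1) (hn : ∀ x, ‖u x‖ ≤ 1) :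
    ‖∏ᶠ n, u (y n)‖ ≤ 1 := by
  obtain ⟨M, hM⟩ := (eventually_prod_eq_finprod hy hB hu).exists
  rw [← hM, norm_prod]
  exact Finset.prod_le_one (fun _ _ => norm_nonneg _) fun n _ => hn _

theorem tendsto_finprod (hy : Function.Injective y) {u : E → ℂ} {v : ℕ → E → ℂ} {B : Set E}
    (hB : (range y ∩ B).Finite) (hu : ∀ x ∉ B, u x = 1) (hv : ∀ k, ∀ x ∉ B, v k x = 1)
    (hlim : ∀ x, Tendsto (fun k => v k x) atTop (𝓝 (u x))) :
    Tendsto (fun k => ∏ᶠ n, v k (y n)) atTop (𝓝 (∏ᶠ n, u (y n))) := by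
  have hf := finite_index_of_finite_points hy hB
  have e : ∀ w : E → ℂ, (∀ x ∉ B, w x = 1) → ∏ᶠ n, w (y n) = ∏ n ∈ hf.toFinset, w (y n) :=
    fun w hw => finprod_eq_prod_of_mulSupport_subset _ (by
      rw [Finite.coe_toFinset]
      exact mulSupport_subset_of_eq_one hw)
  rw [e u hu]
  simp only [fun k => e (v k) (hv k)]
  exact tendsto_finsetProd _ fun n _ => hlim _

end Points

/-! ### The generating functional of a Poisson process -/

theorem integral_pow_poissonMeasure (r : NNReal) (c : ℂ) :
    ∫ n, c ^ n ∂poissonMeasure r = Complex.exp (r * (c - 1)) := by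
  rw [integral_poissonMeasure]
  have h : ∀ n : ℕ, (Real.exp (-r) * r ^ n / n.factorial) • c ^ n
      = Complex.exp (-r) * ((r * c) ^ n / n.factorial) := by
    intro n
    rw [Complex.real_smul, mul_pow]
    push_cast
    ring
  simp only [h]
  rw [tsum_mul_left, (NormedSpace.expSeries_div_hasSum_exp (r * c : ℂ)).tsum_eq,
    ← Complex.exp_eq_exp_ℂ, ← Complex.exp_add]
  congr 1
  ring

section Poisson

variable {Ω E : Type*} [MeasurableSpace Ω] [MeasurableSpace E] {P : Measure Ω}
  {μ : Measure E}

/-- A `ℕ∞`-valued variable with the point probabilities of a probability measure `ν` on `ℕ` is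
almost surely finite, and its finite version has law `ν`. -/
theorem ae_ne_top_and_map_toNat [IsProbabilityMeasure P] {N : Ω → ℕ∞} (hN : Measurable N)
    (ν : Measure ℕ) [IsProbabilityMeasure ν] (h : ∀ k : ℕ, P {ω | N ω = k} = ν {k}) :
    (∀ᵐ ω ∂P, N ω ≠ ⊤) ∧ P.map (fun ω => (N ω).toNat) = ν := by
  have hT : ∀ s : Set ℕ∞, MeasurableSet (N ⁻¹' s) := fun s => hN (.of_discrete)
  have hsum : P (⋃ k : ℕ, {ω | N ω = k}) = 1 := by
    rw [measure_iUnion]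
    · simp only [h]
      rw [← measure_iUnion, iUnion_of_singleton, measure_univ]
      · intro i j hij
        simpa using hij
      · exact fun _ => .singleton _
    · intro i j hij
      rw [Function.onFun, Set.disjoint_left]
      intro ω hi hj
      have : (i : ℕ∞) = j := (show N ω = i from hi).symm.trans hj
      exact hij (by exact_mod_cast this)
    · exact fun k => hT {(k : ℕ∞)}
  have hae : ∀ᵐ ω ∂P, N ω ≠ ⊤ := by
    have h0 : P (⋃ k : ℕ, {ω | N ω = k})ᶜ = 0 := by
      rw [prob_compl_eq_zero_iff, hsum]
      exact MeasurableSet.iUnion fun k => hT {(k : ℕ∞)}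
    filter_upwards [compl_mem_ae_iff.2 h0] with ω hω
    rw [compl_compl] at hω
    obtain ⟨k, hk⟩ := mem_iUnion.1 hω
    rw [show N ω = k from hk]
    exact ENat.natCast_ne_top k
  refine ⟨hae, ?_⟩
  have hm : Measurable fun ω => (N ω).toNat := (Measurable.of_discrete (f := ENat.toNat)).comp hN
  rw [Measure.ext_iff_singleton]
  intro k
  rw [Measure.map_apply hm (.singleton _), ← h k]
  refine measure_congr ?_
  filter_upwards [hae] with ω hω
  refine propext ?_
  change (N ω).toNat = k ↔ N ω = k
  constructor
  · rintro rfl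
    exact (ENat.natCast_toNat hω).symm
  · intro h
    rw [h, ENat.toNat_natCast]

theorem IsPoissonProcess.ae_finite [IsProbabilityMeasure P] {Ψ : Ω → Set E}
    (h : IsPoissonProcess P μ Ψ) {B : Set E} (hB : MeasurableSet B) (hμ : μ B ≠ ⊤) :
    ∀ᵐ ω ∂P, (Ψ ω ∩ B).Finite := by
  filter_upwards [(ae_ne_top_and_map_toNat (h.measurable_count B hB) _ (h.count_law B hB hμ)).1]
    with ω hω
  exact encard_ne_top_iff.1 hω

theorem IsPoissonProcess.iIndepFun_count {Ψ : Ω → Set E} (h : IsPoissonProcess P μ Ψ)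
    {ι : Type*} [Fintype ι] {B : ι → Set E} (hm : ∀ i, MeasurableSet (B i))
    (hB : Pairwise fun i j => Disjoint (B i) (B j)) :
    iIndepFun (fun i ω => (Ψ ω ∩ B i).encard) P := by
  have e := Fintype.equivFin ι
  have := h.count_indep _ (fun k => B (e.symm k)) (fun k => hm _)
    (fun i j hij => hB (e.symm.injective.ne hij))
  simpa using this.precomp e.injective

theorem IsPoissonProcess.integral_prod_pow [IsProbabilityMeasure P] {Ψ : Ω → Set E}
    (h : IsPoissonProcess P μ Ψ) {ι : Type*} [Fintype ι] {B : ι → Set E}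
    (hm : ∀ i, MeasurableSet (B i)) (hB : Pairwise fun i j => Disjoint (B i) (B j))
    (hμ : ∀ i, μ (B i) ≠ ⊤) (c : ι → ℂ) :
    ∫ ω, ∏ i, c i ^ (Ψ ω ∩ B i).encard.toNat ∂P
      = Complex.exp (∑ i, ((μ (B i)).toReal : ℂ) * (c i - 1)) := by
  have hmN := fun i => h.measurable_count (B i) (hm i)
  rw [(h.iIndepFun_count hm hB).integral_fun_prod_comp (f := fun i n => c i ^ n.toNat)
    (fun i => (hmN i).aemeasurable) (fun i => Measurable.aestronglyMeasurable .of_discrete),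
    Complex.exp_sum]
  refine Finset.prod_congr rfl fun i _ => ?_
  have hl := (ae_ne_top_and_map_toNat (hmN i) _ (h.count_law (B i) (hm i) (hμ i))).2
  have : ((μ (B i)).toReal : ℂ) = ((μ (B i)).toNNReal : ℂ) := rfl
  rw [this, ← integral_pow_poissonMeasure, ← hl, integral_map]
  · exact ((Measurable.of_discrete (f := ENat.toNat)).comp (hmN i)).aemeasurable
  · exact Measurable.aestronglyMeasurable .of_discrete

variable {X : ℕ → Ω → E}

theorem aestronglyMeasurable_finprod (hX : ∀ n, Measurable (X n))
    (hinj : ∀ᵐ ω ∂P, Function.Injective fun n => X n ω) {B : Set E}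
    (hfin : ∀ᵐ ω ∂P, ((range fun n => X n ω) ∩ B).Finite) {u : E → ℂ} (hum : Measurable u)
    (hu : ∀ x ∉ B, u x = 1) : AEStronglyMeasurable (fun ω => ∏ᶠ n, u (X n ω)) P := by
  refine aestronglyMeasurable_of_tendsto_ae atTop
    (f := fun M ω => ∏ n ∈ Finset.range M, u (X n ω)) (fun M => ?_) ?_
  · exact (Finset.measurable_prod _ fun n _ => hum.comp (hX n)).aestronglyMeasurable
  · filter_upwards [hinj, hfin] with ω h1 h2
    exact tendsto_nhds_of_eventually_eq (eventually_prod_eq_finprod h1 h2 hu)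

theorem tendsto_integral_prod [IsProbabilityMeasure P] (hX : ∀ n, Measurable (X n))
    (hinj : ∀ᵐ ω ∂P, Function.Injective fun n => X n ω) {B : Set E}
    (hfin : ∀ᵐ ω ∂P, ((range fun n => X n ω) ∩ B).Finite) {u : E → ℂ} (hum : Measurable u)
    (hn : ∀ x, ‖u x‖ ≤ 1) (hu : ∀ x ∉ B, u x = 1) :
    Tendsto (fun M => ∫ ω, ∏ n ∈ Finset.range M, u (X n ω) ∂P) atTop
      (𝓝 (∫ ω, ∏ᶠ n, u (X n ω) ∂P)) := by
  refine tendsto_integral_of_dominated_convergence (fun _ => 1) (fun M => ?_)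
    (integrable_const _) (fun M => ?_) ?_
  · exact (Finset.measurable_prod _ fun n _ => hum.comp (hX n)).aestronglyMeasurable
  · refine .of_forall fun ω => ?_
    rw [norm_prod]
    exact Finset.prod_le_one (fun _ _ => norm_nonneg _) fun n _ => hn _
  · filter_upwards [hinj, hfin] with ω h1 h2
    exact tendsto_nhds_of_eventually_eq (eventually_prod_eq_finprod h1 h2 hu)

/-- The generating functional of a Poisson process whose points are enumerated by `X`. For a
simple function it is computed from the counts of points in disjoint sets; the general case
follows by dominated convergence. -/
theorem IsPoissonProcess.integral_finprod [IsProbabilityMeasure P] (hX : ∀ n, Measurable (X n))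
    (hinj : ∀ᵐ ω ∂P, Function.Injective fun n => X n ω)
    (h : IsPoissonProcess P μ fun ω => range fun n => X n ω) {B : Set E}
    (hB : MeasurableSet B) (hμ : μ B ≠ ⊤) {u : E → ℂ} (hum : Measurable u)
    (hn : ∀ x, ‖u x‖ ≤ 1) (hu : ∀ x ∉ B, u x = 1) :
    ∫ ω, ∏ᶠ n, u (X n ω) ∂P = Complex.exp (∫ x in B, (u x - 1) ∂μ) := by
  have hfin := h.ae_finite hB hμ
  have hsimple : ∀ v : SimpleFunc E ℂ, (∀ x ∉ B, v x = 1) →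
      ∫ ω, ∏ᶠ n, v (X n ω) ∂P = Complex.exp (∫ x in B, (v x - 1) ∂μ) := by
    intro v hv
    let S : Finset ℂ := v.range.erase 1
    let A : S → Set E := fun i => v ⁻¹' {(i : ℂ)}
    have hA : Pairwise fun i j => Disjoint (A i) (A j) := by
      intro i j hij
      rw [Set.disjoint_left]
      intro x hi hj
      exact hij (Subtype.ext ((show v x = i from hi).symm.trans hj))
    have hAm : ∀ i, MeasurableSet (A i) := fun i => v.measurableSet_fiber _
    have hAB : ∀ i, A i ⊆ B := by
      intro i x hx
      by_contra hxB
      exact (Finset.mem_erase.1 i.2).1 ((show v x = i from hx).symm.trans (hv x hxB))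
    have hstep : ∀ x, v x = stepFun A (fun i => (i : ℂ)) x := by
      intro x
      by_cases h1 : v x = 1
      · rw [stepFun_of_notMem, h1]
        intro i hi
        exact (Finset.mem_erase.1 i.2).1 ((show v x = i from hi).symm.trans h1)
      · rw [stepFun_of_mem hA _ (i := ⟨v x, Finset.mem_erase.2 ⟨h1, v.mem_range_self x⟩⟩)]
        rfl
    simp only [hstep]
    rw [setIntegral_stepFun_sub_one hμ hA hAm hAB,
      ← h.integral_prod_pow hAm hA fun i => ne_top_of_le_ne_top hμ (measure_mono (hAB i))]
    refine integral_congr_ae ?_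
    filter_upwards [hinj, hfin] with ω h1 h2
    exact finprod_stepFun h1 (fun i => h2.subset (inter_subset_inter_right _ (hAB i))) _
  let K : Set ℂ := Metric.closedBall 0 1
  have hK1 : (1 : ℂ) ∈ K := by simp [K]
  have huK : ∀ x, u x ∈ K := fun x => by simpa [K] using hn x
  -- The default value `1` of the approximations keeps them equal to `1` outside `B`.
  let v : ℕ → SimpleFunc E ℂ := SimpleFunc.approxOn u hum K 1 hK1
  have hv1 : ∀ k, ∀ x ∉ B, v k x = 1 := by
    intro k x hx
    have := SimpleFunc.edist_approxOn_y0_le hum hK1 x k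
    rw [hu x hx, edist_self, add_zero, nonpos_iff_eq_zero, edist_eq_zero] at this
    exact this.symm
  have hvn : ∀ k x, ‖v k x‖ ≤ 1 := by
    intro k x
    have := SimpleFunc.approxOn_mem hum hK1 k x
    simpa [K] using this
  have hvlim : ∀ x, Tendsto (fun k => v k x) atTop (𝓝 (u x)) := fun x =>
    SimpleFunc.tendsto_approxOn hum hK1 (subset_closure (huK x))
  have l1 : Tendsto (fun k => ∫ ω, ∏ᶠ n, v k (X n ω) ∂P) atTop
      (𝓝 (∫ ω, ∏ᶠ n, u (X n ω) ∂P)) := by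
    refine tendsto_integral_of_dominated_convergence (fun _ => 1) (fun k => ?_)
      (integrable_const _) (fun k => ?_) ?_
    · exact aestronglyMeasurable_finprod hX hinj hfin (v k).measurable (hv1 k)
    · filter_upwards [hinj, hfin] with ω h1 h2
      exact norm_finprod_le_one h1 h2 (hv1 k) (hvn k)
    · filter_upwards [hinj, hfin] with ω h1 h2
      exact tendsto_finprod h1 h2 hu hv1 hvlim
  have l2 : Tendsto (fun k => ∫ x in B, (v k x - 1) ∂μ) atTop (𝓝 (∫ x in B, (u x - 1) ∂μ)) := by
    have : IsFiniteMeasure (μ.restrict B) := ⟨by simpa using hμ.lt_top⟩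
    refine tendsto_integral_of_dominated_convergence (fun _ => 2) (fun k => ?_)
      (integrable_const _) (fun k => .of_forall fun x => ?_)
      (.of_forall fun x => (hvlim x).sub_const 1)
    · exact ((v k).measurable.sub_const 1).aestronglyMeasurable
    · calc ‖v k x - 1‖ ≤ ‖v k x‖ + ‖(1 : ℂ)‖ := norm_sub_le _ _
        _ ≤ 2 := by
          rw [norm_one]
          linarith [hvn k x]
  refine tendsto_nhds_unique l1 ?_
  simp only [fun k => hsimple (v k) (hv1 k)]
  exact (Complex.continuous_exp.tendsto _).comp l2

end Poisson

/-! ### Independent marking of a Poisson process -/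

theorem injective_marked {E K : Type*} {x : ℕ → E} (hx : Function.Injective x) (z : ℕ → K) :
    Function.Injective fun n => (x n, z n) := fun _ _ h => hx (congrArg Prod.fst h)

theorem finite_marked {E K : Type*} {x : ℕ → E} (hx : Function.Injective x) (z : ℕ → K)
    {B : Set E} (hB : (range x ∩ B).Finite) : ((range fun n => (x n, z n)) ∩ B ×ˢ univ).Finite := by
  refine ((finite_index_of_finite_points hx hB).image fun n => (x n, z n)).subset ?_
  rintro _ ⟨⟨n, rfl⟩, hn⟩
  exact ⟨n, hn.1, rfl⟩

section Marking

variable {Ω E K : Type*} [MeasurableSpace Ω] [MeasurableSpace E] [MeasurableSpace K]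
  {P : Measure Ω} [IsProbabilityMeasure P] {μ : Measure E} {ρ : Measure K}
  [IsProbabilityMeasure ρ] {X : ℕ → Ω → E} {Z : ℕ → Ω → K}

/-- Averaging a product over the first points with respect to the independent marks. -/
theorem integral_prod_marked (hX : ∀ n, Measurable (X n)) (hZ : ∀ n, Measurable (Z n))
    (hlaw : ∀ n, P.map (Z n) = ρ) (hind : iIndepFun Z P)
    (hXZ : IndepFun (fun ω n => X n ω) (fun ω n => Z n ω) P) {g : E × K → ℂ}
    (hg : Measurable g) (hn : ∀ p, ‖g p‖ ≤ 1) (M : ℕ) :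
    ∫ ω, ∏ n ∈ Finset.range M, g (X n ω, Z n ω) ∂P
      = ∫ ω, ∏ n ∈ Finset.range M, ∫ z, g (X n ω, z) ∂ρ ∂P := by
  have hXm : Measurable fun ω (i : Fin M) => X i ω := measurable_pi_lambda _ fun i => hX i
  have hZm : Measurable fun ω (i : Fin M) => Z i ω := measurable_pi_lambda _ fun i => hZ i
  have hZlaw : P.map (fun ω (i : Fin M) => Z i ω) = Measure.pi fun _ => ρ := by
    have hp : iIndepFun (fun i : Fin M => Z i) P := hind.precomp Fin.val_injective
    have := (iIndepFun_iff_map_fun_eq_pi_map (f := fun (i : Fin M) => Z i)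
      fun i => (hZ i).aemeasurable).1 hp
    simpa only [hlaw] using this
  have hI : IndepFun (fun ω (i : Fin M) => X i ω) (fun ω (i : Fin M) => Z i ω) P :=
    hXZ.comp (φ := fun (x : ℕ → E) (i : Fin M) => x i)
      (ψ := fun (x : ℕ → K) (i : Fin M) => x i)
      (by fun_prop) (by fun_prop)
  have hjoint := hI.map_prod_eq_prod_map_map hXm.aemeasurable hZm.aemeasurable
  rw [hZlaw] at hjoint
  let H : (Fin M → E) × (Fin M → K) → ℂ := fun v => ∏ i, g (v.1 i, v.2 i)
  have hHm : Measurable H := Finset.measurable_prod _ fun i _ => hg.comp (by fun_prop)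
  have hXp : IsProbabilityMeasure (P.map fun ω (i : Fin M) => X i ω) :=
    Measure.isProbabilityMeasure_map hXm.aemeasurable
  have hHi : Integrable H ((P.map fun ω (i : Fin M) => X i ω).prod (Measure.pi fun _ => ρ)) := by
    refine Integrable.of_bound hHm.aestronglyMeasurable 1 (.of_forall fun v => ?_)
    rw [norm_prod]
    exact Finset.prod_le_one (fun _ _ => norm_nonneg _) fun i _ => hn _
  have hgm : Measurable fun x => ∫ z, g (x, z) ∂ρ :=
    (hg.stronglyMeasurable.integral_prod_right').measurable
  calc ∫ ω, ∏ n ∈ Finset.range M, g (X n ω, Z n ω) ∂P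
      = ∫ ω, H (fun i => X i ω, fun i => Z i ω) ∂P := by
        simp only [H, Finset.prod_range]
    _ = ∫ v, H v ∂((P.map fun ω (i : Fin M) => X i ω).prod (Measure.pi fun _ => ρ)) := by
        rw [← hjoint, integral_map (hXm.prodMk hZm).aemeasurable hHm.aestronglyMeasurable]
    _ = ∫ x, ∏ i, ∫ z, g (x i, z) ∂ρ ∂(P.map fun ω (i : Fin M) => X i ω) := by
        rw [integral_prod _ hHi]
        refine integral_congr_ae (.of_forall fun x => ?_)
        exact integral_fintype_prod_eq_prod (fun i z => g (x i, z))
    _ = ∫ ω, ∏ n ∈ Finset.range M, ∫ z, g (X n ω, z) ∂ρ ∂P := by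
        rw [integral_map hXm.aemeasurable]
        · simp only [Finset.prod_range]
        · exact (Finset.measurable_prod _ fun i _ =>
            hgm.comp (measurable_pi_apply i)).aestronglyMeasurable

/-- The generating functional of an independently marked Poisson process is that of a Poisson
process with intensity `μ.prod ρ`. -/
theorem IsPoissonProcess.integral_finprod_marked [SFinite μ] (hX : ∀ n, Measurable (X n))
    (hZ : ∀ n, Measurable (Z n)) (hinj : ∀ᵐ ω ∂P, Function.Injective fun n => X n ω)
    (h : IsPoissonProcess P μ fun ω => range fun n => X n ω)
    (hlaw : ∀ n, P.map (Z n) = ρ) (hind : iIndepFun Z P)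
    (hXZ : IndepFun (fun ω n => X n ω) (fun ω n => Z n ω) P)
    {B : Set E} (hB : MeasurableSet B) (hμ : μ B ≠ ⊤) {g : E × K → ℂ}
    (hg : Measurable g) (hn : ∀ p, ‖g p‖ ≤ 1) (hg1 : ∀ p ∉ B ×ˢ (univ : Set K), g p = 1) :
    ∫ ω, ∏ᶠ n, g (X n ω, Z n ω) ∂P
      = Complex.exp (∫ p in B ×ˢ (univ : Set K), (g p - 1) ∂(μ.prod ρ)) := by
  have hfin := h.ae_finite hB hμ
  have hgm : Measurable fun x => ∫ z, g (x, z) ∂ρ :=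
    (hg.stronglyMeasurable.integral_prod_right').measurable
  have hgn : ∀ x, ‖∫ z, g (x, z) ∂ρ‖ ≤ 1 := by
    intro x
    simpa using norm_integral_le_of_norm_le_const (μ := ρ) (.of_forall fun z => hn (x, z))
  have hgx : ∀ x ∉ B, ∫ z, g (x, z) ∂ρ = 1 := by
    intro x hx
    have : ∀ z, g (x, z) = 1 := fun z => hg1 _ fun h' => hx h'.1
    simp [this]
  -- Both products are limits of products over the first `M` points, for which the marks can be
  -- averaged.
  have l1 := tendsto_integral_prod (P := P) (X := fun n ω => (X n ω, Z n ω))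
    (fun n => (hX n).prodMk (hZ n)) (B := B ×ˢ univ)
    (by
      filter_upwards [hinj] with ω h1
      exact injective_marked h1 _)
    (by
      filter_upwards [hinj, hfin] with ω h1 h2
      exact finite_marked h1 _ h2) hg hn hg1
  have l2 := tendsto_integral_prod hX hinj hfin hgm hgn hgx
  simp only [integral_prod_marked hX hZ hlaw hind hXZ hg hn] at l1
  rw [tendsto_nhds_unique l1 l2, h.integral_finprod hX hinj hB hμ hgm hgn hgx]
  congr 1
  have : IsFiniteMeasure (μ.restrict B) := ⟨by simpa using hμ.lt_top⟩
  have hgi : Integrable (fun p => g p - 1) ((μ.restrict B).prod ρ) := by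
    refine (Integrable.of_bound hg.aestronglyMeasurable 1 (.of_forall hn)).sub
      (integrable_const _)
  have hr : (μ.prod ρ).restrict (B ×ˢ univ) = (μ.restrict B).prod ρ := by
    rw [← Measure.prod_restrict, Measure.restrict_univ]
  rw [hr, integral_prod _ hgi]
  refine integral_congr_ae (.of_forall fun x => ?_)
  have hxi : Integrable (fun z => g (x, z)) ρ :=
    Integrable.of_bound (hg.comp measurable_prodMk_left).aestronglyMeasurable 1
      (.of_forall fun z => hn _)
  simp only
  rw [integral_sub hxi (integrable_const _)]
  simp

/-- The numbers of marked points in disjoint sets are independent Poisson variables: their joint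
characteristic function is a value of the generating functional. -/
theorem IsPoissonProcess.count_marked [SFinite μ] (hX : ∀ n, Measurable (X n))
    (hZ : ∀ n, Measurable (Z n)) (hinj : ∀ᵐ ω ∂P, Function.Injective fun n => X n ω)
    (h : IsPoissonProcess P μ fun ω => range fun n => X n ω)
    (hlaw : ∀ n, P.map (Z n) = ρ) (hind : iIndepFun Z P)
    (hXZ : IndepFun (fun ω n => X n ω) (fun ω n => Z n ω) P)
    {S : Ω → Set (E × K)} (hS : ∀ᵐ ω ∂P, S ω = range fun n => (X n ω, Z n ω))
    (hSm : ∀ C, MeasurableSet C → Measurable fun ω => (S ω ∩ C).encard)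
    {B : Set E} (hB : MeasurableSet B) (hμ : μ B ≠ ⊤) {ι : Type*} [Fintype ι]
    {C : ι → Set (E × K)} (hC : ∀ i, MeasurableSet (C i))
    (hCd : Pairwise fun i j => Disjoint (C i) (C j)) (hCB : ∀ i, C i ⊆ B ×ˢ univ) (k : ι → ℕ) :
    P {ω | ∀ i, (S ω ∩ C i).encard = k i}
      = ∏ i, poissonMeasure (μ.prod ρ (C i)).toNNReal {k i} := by
  have hfin : ∀ᵐ ω ∂P, ∀ i, (S ω ∩ C i).Finite := by
    filter_upwards [hinj, h.ae_finite hB hμ, hS] with ω h1 h2 h3 i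
    rw [h3]
    exact (finite_marked h1 _ h2).subset (inter_subset_inter_right _ (hCB i))
  have hW : μ.prod ρ (B ×ˢ univ) ≠ ⊤ := by
    rw [Measure.prod_prod, measure_univ, mul_one]
    exact hμ
  let V : Ω → ι → ℝ := fun ω i => ((S ω ∩ C i).encard.toNat : ℝ)
  have hVm : Measurable V := measurable_pi_lambda _ fun i =>
    (Measurable.of_discrete (f := fun n : ℕ∞ => (n.toNat : ℝ))).comp (hSm _ (hC i))
  have : IsProbabilityMeasure (P.map V) := Measure.isProbabilityMeasure_map hVm.aemeasurable
  have hV : P.map V = Measure.pi fun i =>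
      (poissonMeasure (μ.prod ρ (C i)).toNNReal).map (Nat.cast : ℕ → ℝ) := by
    rw [← charFun_eq_pi_iff]
    intro t
    let c : ι → ℂ := fun i => Complex.exp (t.ofLp i * Complex.I)
    have hcn : ∀ i, ‖c i‖ ≤ 1 := fun i => (Complex.norm_exp_ofReal_mul_I _).le
    simp only [charFun_map_cast_poissonMeasure]
    have e1 : charFun ((P.map V).map (WithLp.toLp 2)) t
        = ∫ ω, ∏ i, c i ^ (S ω ∩ C i).encard.toNat ∂P := by
      rw [charFun_apply, integral_map (by fun_prop) (Measurable.aestronglyMeasurable (by fun_prop)),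
        integral_map hVm.aemeasurable (Measurable.aestronglyMeasurable (by fun_prop))]
      refine integral_congr_ae (.of_forall fun ω => ?_)
      simp only [PiLp.inner_apply, c, V, ← Complex.exp_nat_mul, ← Complex.exp_sum]
      congr 1
      rw [Complex.ofReal_sum, Finset.sum_mul]
      refine Finset.sum_congr rfl fun i _ => ?_
      simp
      ring
    rw [e1, ← Complex.exp_sum]
    have e2 : ∫ ω, ∏ i, c i ^ (S ω ∩ C i).encard.toNat ∂P
        = ∫ ω, ∏ᶠ n, stepFun C c (X n ω, Z n ω) ∂P := by
      refine integral_congr_ae ?_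
      filter_upwards [hinj, hS, hfin] with ω h1 h2 h3
      simp only [h2] at h3 ⊢
      exact (finprod_stepFun (injective_marked h1 _) h3 c).symm
    rw [e2, h.integral_finprod_marked hX hZ hinj hlaw hind hXZ hB hμ (measurable_stepFun hC c)
      (norm_stepFun_le hcn) (fun p hp => stepFun_of_notMem c fun i hi => hp (hCB i hi)),
      setIntegral_stepFun_sub_one hW hCd hC hCB]
    rfl
  have hpt : P {ω | ∀ i, (S ω ∩ C i).encard = k i} = P.map V {fun i => (k i : ℝ)} := by
    rw [Measure.map_apply hVm (.singleton _)]
    refine measure_congr ?_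
    filter_upwards [hfin] with ω hω
    refine propext ?_
    change (∀ i, (S ω ∩ C i).encard = k i) ↔ V ω = fun i => (k i : ℝ)
    rw [funext_iff]
    refine forall_congr' fun i => ?_
    have hne := encard_ne_top_iff.2 (hω i)
    simp only [V, Nat.cast_inj]
    constructor
    · intro h
      rw [h, ENat.toNat_natCast]
    · intro h
      rw [← h, ENat.natCast_toNat hne]
  rw [hpt, hV, Measure.pi_singleton]
  refine Finset.prod_congr rfl fun i _ => ?_
  rw [Measure.map_apply .of_discrete (.singleton _)]
  congr 1
  ext n
  simp

end Marking

/-! ### The space of configurations -/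

instance : LocallyCompactSpace (Ioi (0 : ℝ)) :=
  isOpen_Ioi.isOpenEmbedding_subtypeVal.locallyCompactSpace

theorem measurable_of_le_nat {α : Type*} [MeasurableSpace α] {g : α → ℕ∞}
    (h : ∀ k : ℕ, MeasurableSet {x | g x ≤ k}) : Measurable g := by
  have hcoe : ∀ k : ℕ, MeasurableSet {x | g x = k} := by
    intro k
    cases k with
    | zero => simpa using h 0
    | succ k =>
      have : {x | g x = (k + 1 : ℕ)} = {x | g x ≤ (k + 1 : ℕ)} \ {x | g x ≤ k} := by
        ext x
        simp only [mem_ofPred_eq, Set.mem_sdiff, not_le]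
        constructor
        · intro hx
          rw [hx]
          exact ⟨le_rfl, by exact_mod_cast k.lt_succ_self⟩
        · rintro ⟨h1, h2⟩
          refine le_antisymm h1 ?_
          rw [Nat.cast_succ]
          exact Order.add_one_le_of_lt h2
      rw [this]
      exact (h _).diff (h _)
  refine measurable_to_countable' fun n => ?_
  induction n with
  | top =>
    have : g ⁻¹' {⊤} = (⋃ k : ℕ, {x | g x = k})ᶜ := by
      ext x
      simp only [mem_preimage, mem_singleton_iff, mem_compl_iff, mem_iUnion, mem_ofPred_eq]
      constructor
      · rintro hx ⟨k, hk⟩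
        rw [hx] at hk
        exact ENat.top_ne_natCast k hk
      · intro hx
        by_contra hne
        exact hx ⟨_, (ENat.natCast_toNat hne).symm⟩
    rw [this]
    exact (MeasurableSet.iUnion hcoe).compl
  | coe k => exact hcoe k

theorem encard_le_of_forall_inter {α : Type*} {s : Set α} {S : ℕ → Set α} (hS : Monotone S)
    (hU : ⋃ m, S m = univ) {k : ℕ} (h : ∀ m, (s ∩ S m).encard ≤ k) : s.encard ≤ k := by
  by_contra! hlt
  obtain ⟨t, hts, ht⟩ := exists_subset_encard_eq (Order.add_one_le_of_lt hlt)
  have htf : t.Finite := by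
    rw [← encard_ne_top_iff, ht]
    exact_mod_cast ENat.natCast_ne_top (k + 1)
  have hm : ∃ m, t ⊆ S m := by
    have hx : ∀ x : α, ∃ m, x ∈ S m := fun x => mem_iUnion.1 (hU ▸ mem_univ x)
    choose m hm using hx
    refine ⟨htf.toFinset.sup m, fun x hx => hS ?_ (hm x)⟩
    exact Finset.le_sup (f := m) (htf.mem_toFinset.2 hx)
  obtain ⟨m, hm⟩ := hm
  have h1 : t.encard ≤ k := (encard_le_encard (subset_inter hts hm)).trans (h m)
  rw [ht] at h1
  have : (k : ℕ∞) < k + 1 := by exact_mod_cast k.lt_succ_self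
  exact absurd h1 (not_le.2 this)

theorem encard_inter_biUnion {α ι : Type*} (s : Set α) {C : ι → Set α}
    (hC : Pairwise fun i j => Disjoint (C i) (C j)) (S : Finset ι) :
    (s ∩ ⋃ i ∈ S, C i).encard = ∑ i ∈ S, (s ∩ C i).encard := by
  classical
  induction S using Finset.induction_on with
  | empty => simp
  | insert i S hi ih =>
    rw [Finset.set_biUnion_insert, inter_union_distrib_left, encard_union_eq, ih,
      Finset.sum_insert hi]
    refine Disjoint.mono inter_subset_right inter_subset_right ?_
    rw [disjoint_iUnion₂_right]
    exact fun j hj => hC (ne_of_mem_of_not_mem hj hi).symm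

namespace Config

theorem measurable_encard {B : Set H3} (hB : MeasurableSet B) :
    Measurable fun φ : Config => (φ.1 ∩ B).encard :=
  Measurable.of_comap_le (le_iSup (fun B : {B : Set H3 // MeasurableSet B} =>
    MeasurableSpace.comap (fun φ : Config => (φ.1 ∩ B.1).encard) inferInstance) ⟨B, hB⟩)

theorem measurable_of_encard {α : Type*} [MeasurableSpace α] {g : α → Config}
    (h : ∀ B, MeasurableSet B → Measurable fun x => ((g x).1 ∩ B).encard) : Measurable g := by
  refine Measurable.of_comap_le ?_
  rw [instMeasurableSpace, MeasurableSpace.comap_iSup]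
  refine iSup_le fun B => ?_
  rw [MeasurableSpace.comap_comp]
  exact (h B.1 B.2).comap_le

/-- For every exhaustion `S`, the sigma-algebra of configurations is generated by the counts in the
sets `B ∩ S m`. -/
theorem instMeasurableSpace_le {S : ℕ → Set H3} (hS : Monotone S) (hU : ⋃ m, S m = univ)
    {m' : MeasurableSpace Config}
    (h : ∀ m, ∀ B : Set H3, MeasurableSet B →
      Measurable[m'] fun φ : Config => (φ.1 ∩ (B ∩ S m)).encard) :
    instMeasurableSpace ≤ m' := by
  refine iSup_le fun B => Measurable.comap_le (m₁ := m') ?_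
  refine @measurable_of_le_nat _ m' _ fun k => ?_
  have : {φ : Config | (φ.1 ∩ B.1).encard ≤ k}
      = ⋂ m, {φ : Config | (φ.1 ∩ (B.1 ∩ S m)).encard ≤ k} := by
    ext φ
    simp only [mem_iInter]
    constructor
    · exact fun h m => (encard_le_encard (inter_subset_inter_right _ inter_subset_left)).trans h
    · intro h
      refine encard_le_of_forall_inter hS hU fun m => ?_
      rw [inter_assoc]
      exact h m
  rw [this]
  exact @MeasurableSet.iInter _ _ m' _ _ fun m => h m B.1 B.2 (t := Iic (k : ℕ∞)) .of_discrete

theorem isClosed (φ : Config) : IsClosed φ.1 := by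
  rw [← isOpen_compl_iff, isOpen_iff_mem_nhds]
  intro x hx
  obtain ⟨K, hK, hxK⟩ := exists_compact_mem_nhds x
  have h1 : (φ.1 ∩ K)ᶜ ∈ 𝓝 x :=
    (φ.2 K hK).isClosed.isOpen_compl.mem_nhds fun h => hx h.1
  filter_upwards [h1, hxK] with y hy hyK hyφ
  exact hy ⟨hyφ, hyK⟩

theorem countable (φ : Config) : φ.1.Countable := by
  rw [← inter_univ φ.1, ← iUnion_compactCovering H3, inter_iUnion]
  exact countable_iUnion fun n => (φ.2 _ (isCompact_compactCovering H3 n)).countable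

/-- Whether `a` is a point of `φ` depends measurably on `(a, φ)`: as `φ` is closed, this can be
tested on the neighbourhoods of `a` in a countable basis. -/
theorem measurableSet_mem : MeasurableSet {p : H3 × Config | p.1 ∈ p.2.1} := by
  have h : {p : H3 × Config | p.1 ∈ p.2.1} = ⋂ U ∈ TopologicalSpace.countableBasis H3,
      {p : H3 × Config | p.1 ∈ U → (p.2.1 ∩ U).encard ≠ 0} := by
    ext ⟨a, φ⟩
    simp only [mem_iInter, mem_ofPred_eq]
    constructor
    · intro ha U _ haU
      rw [Ne, encard_eq_zero]
      exact Set.Nonempty.ne_empty ⟨a, ha, haU⟩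
    · intro h
      rw [← φ.isClosed.closure_eq,
        (TopologicalSpace.isBasis_countableBasis H3).mem_closure_iff]
      intro U hU haU
      rw [inter_comm, nonempty_iff_ne_empty, Ne, ← encard_eq_zero]
      exact h U hU haU
  rw [h]
  refine MeasurableSet.biInter (TopologicalSpace.countable_countableBasis H3) fun U hU => ?_
  have hUm : MeasurableSet U := (TopologicalSpace.isOpen_of_mem_countableBasis hU).measurableSet
  have h1 : MeasurableSet {p : H3 × Config | p.1 ∈ U} := measurable_fst hUm
  have h2 : MeasurableSet {p : H3 × Config | (p.2.1 ∩ U).encard ≠ 0} :=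
    ((measurable_encard hUm).comp measurable_snd) (t := {0}ᶜ) .of_discrete
  exact h1.imp h2

/-- Add one point to a configuration. -/
def addPoint (φ : Config) (a : H3) : Config :=
  ⟨insert a φ.1, fun K hK => ((φ.2 K hK).insert a).subset (by
    rintro x ⟨rfl | hx, hK⟩
    · exact Or.inl rfl
    · exact Or.inr ⟨hx, hK⟩)⟩

theorem addPair_eq (φ : Config) (a b : H3) : φ.addPair a b = (φ.addPoint b).addPoint a := rfl

open scoped Classical in
theorem encard_addPoint (φ : Config) (a : H3) (B : Set H3) :
    ((φ.addPoint a).1 ∩ B).encard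
      = if a ∈ B ∧ a ∉ φ.1 then (φ.1 ∩ B).encard + 1 else (φ.1 ∩ B).encard := by
  change (insert a φ.1 ∩ B).encard = _
  split_ifs with h
  · rw [insert_inter_of_mem h.1, encard_insert_of_notMem fun h' => h.2 h'.1]
  · congr 1
    by_cases ha : a ∈ B
    · rw [insert_eq_of_mem (by simpa [ha] using h)]
    · rw [insert_inter_of_notMem ha]

theorem measurable_addPoint : Measurable fun p : H3 × Config => p.2.addPoint p.1 := by
  classical
  refine measurable_of_encard fun B hB => ?_
  simp only [encard_addPoint]
  have h1 : MeasurableSet {p : H3 × Config | p.1 ∈ B} := measurable_fst hB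
  have hN : Measurable fun p : H3 × Config => (p.2.1 ∩ B).encard :=
    (measurable_encard hB).comp measurable_snd
  exact Measurable.ite (h1.inter measurableSet_mem.compl)
    ((Measurable.of_discrete (f := fun n : ℕ∞ => n + 1)).comp hN) hN

theorem measurable_addPair :
    Measurable fun p : (H3 × H3) × Config => p.2.addPair p.1.1 p.1.2 := by
  have h1 : Measurable fun p : (H3 × H3) × Config => p.2.addPoint p.1.2 :=
    measurable_addPoint.comp (f := fun p : (H3 × H3) × Config => (p.1.2, p.2)) (by fun_prop)
  exact measurable_addPoint.comp ((measurable_fst.comp measurable_fst).prodMk h1)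

/-- The sigma-algebra of configurations is countably generated: it is generated by the counts in
the sets of a countable algebra of Borel sets, within the sets of a compact exhaustion. -/
theorem countablyGenerated :
    ∃ Q : Set (Set Config), Q.Countable ∧ instMeasurableSpace = MeasurableSpace.generateFrom Q ∧
      IsPiSystem Q := by
  let A : Set (Set H3) := generateSetAlgebra (MeasurableSpace.countableGeneratingSet H3)
  have hAc : A.Countable :=
    countable_generateSetAlgebra (MeasurableSpace.countable_countableGeneratingSet)
  have hAg : (inferInstance : MeasurableSpace H3) = MeasurableSpace.generateFrom A := by
    rw [generateFrom_generateSetAlgebra_eq,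
      MeasurableSpace.generateFrom_countableGeneratingSet]
  have hAπ : IsPiSystem A := fun s hs t ht _ => isSetAlgebra_generateSetAlgebra.inter_mem hs ht
  let K : ℕ → Set H3 := compactCovering H3
  have hKm : ∀ n, MeasurableSet (K n) := fun n => (isCompact_compactCovering H3 n).measurableSet
  let G : Set (Set Config) :=
    {Γ | ∃ n : ℕ, ∃ B ∈ A, ∃ k : ℕ∞, Γ = {φ : Config | (φ.1 ∩ (B ∩ K n)).encard = k}}
  have hGc : G.Countable := by
    have : G = ⋃ n : ℕ, ⋃ B ∈ A, ⋃ k : ℕ∞,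
        {{φ : Config | (φ.1 ∩ (B ∩ K n)).encard = k}} := by
      ext Γ
      simp only [G, mem_iUnion, mem_singleton_iff, exists_prop, mem_ofPred_eq]
    rw [this]
    exact countable_iUnion fun n => hAc.biUnion fun B _ =>
      countable_iUnion fun k => countable_singleton _
  have hA : ∀ B ∈ A, MeasurableSet B := fun B hB => by
    have h : MeasurableSet[MeasurableSpace.generateFrom A] B :=
      MeasurableSpace.measurableSet_generateFrom hB
    rwa [← hAg] at h
  have hGg : instMeasurableSpace = MeasurableSpace.generateFrom G := by
    refine le_antisymm ?_ (MeasurableSpace.generateFrom_le ?_)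
    · refine instMeasurableSpace_le (S := K) (fun _ _ h => compactCovering_subset H3 h)
        (iUnion_compactCovering H3) fun n B hB => ?_
      let : MeasurableSpace Config := MeasurableSpace.generateFrom G
      let ν : Config → Measure H3 := fun φ => Measure.count.restrict (φ.1 ∩ K n)
      have hνf : ∀ φ, IsFiniteMeasure (ν φ) := fun φ => ⟨by
        rw [Measure.restrict_apply_univ]
        exact Measure.count_apply_lt_top.2 (φ.2 _ (isCompact_compactCovering H3 n))⟩
      have hνB : ∀ B, MeasurableSet B → ∀ φ : Config,
          ν φ B = ((φ.1 ∩ (B ∩ K n)).encard : ENNReal) := by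
        intro B hB φ
        have hφ : MeasurableSet (φ.1 ∩ (B ∩ K n)) :=
          (φ.countable.mono inter_subset_left).measurableSet
        rw [← Measure.count_apply hφ, Measure.restrict_apply hB]
        congr 1
        ext x
        simp only [mem_inter_iff]
        tauto
      have hAν : ∀ B ∈ A, Measurable fun φ => ν φ B := by
        intro B hB
        simp only [hνB B (hA B hB)]
        refine (Measurable.of_discrete (f := fun n : ℕ∞ => (n : ENNReal))).comp ?_
        refine measurable_to_countable' fun k => ?_
        exact MeasurableSpace.measurableSet_generateFrom ⟨n, B, hB, k, rfl⟩
      have hν : Measurable ν := Measurable.measure_of_isPiSystem hAg hAπ hAν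
        (hAν _ isSetAlgebra_generateSetAlgebra.univ_mem)
      have hB' := Measure.measurable_measure.1 hν B hB
      simp only [hνB B hB] at hB'
      refine measurable_of_le_nat fun k => ?_
      have : {φ : Config | (φ.1 ∩ (B ∩ K n)).encard ≤ k}
          = (fun φ : Config => ((φ.1 ∩ (B ∩ K n)).encard : ENNReal)) ⁻¹' Iic (k : ENNReal) := by
        ext φ
        simp only [mem_preimage, mem_Iic, mem_ofPred_eq]
        exact_mod_cast Iff.rfl
      rw [this]
      exact hB' measurableSet_Iic
    · rintro _ ⟨n, B, hB, k, rfl⟩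
      exact measurable_encard ((hA B hB).inter (hKm n)) (t := {k}) .of_discrete
  refine ⟨generateSetAlgebra G, countable_generateSetAlgebra hGc, ?_,
    fun s hs t ht _ => isSetAlgebra_generateSetAlgebra.inter_mem hs ht⟩
  rw [generateFrom_generateSetAlgebra_eq, hGg]

end Config

/-! ### Measures on configurations are determined by counts in disjoint sets -/

/-- The part of the half-space above a disc of the plane. -/
def slab (m : ℕ) : Set H3 := Metric.ball 0 m ×ˢ univ

theorem measurableSet_slab (m : ℕ) : MeasurableSet (slab m) := measurableSet_ball.prod .univ

theorem slab_mono : Monotone slab := fun _ _ h =>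
  prod_mono (Metric.ball_subset_ball (by exact_mod_cast h)) subset_rfl

theorem iUnion_slab : ⋃ m, slab m = univ := by
  refine eq_univ_of_forall fun a => mem_iUnion.2 ?_
  obtain ⟨m, hm⟩ := exists_nat_gt (dist a.1 0)
  exact ⟨m, hm, mem_univ _⟩

theorem exists_common_slab {ι : Type*} (S : Finset ι) {C : ι → Set H3}
    (h : ∀ i ∈ S, ∃ m, C i ⊆ slab m) : ∃ m, ∀ i ∈ S, C i ⊆ slab m := by
  choose! m hm using h
  exact ⟨S.sup m, fun i hi => (hm i hi).trans (slab_mono (Finset.le_sup hi))⟩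

/-- The Borel sets contained in some slab. -/
abbrev SlabSet : Type := {C : Set H3 // MeasurableSet C ∧ ∃ m, C ⊆ slab m}

/-- The counts of a configuration in all sets of `SlabSet`. -/
noncomputable def Config.counts (φ : Config) (B : SlabSet) : ℕ∞ := (φ.1 ∩ B.1).encard

theorem Config.measurable_counts : Measurable Config.counts :=
  measurable_pi_lambda _ fun B => Config.measurable_encard B.2.1

theorem Config.exists_preimage_counts {Γ : Set Config} (hΓ : MeasurableSet Γ) :
    ∃ A, MeasurableSet A ∧ Config.counts ⁻¹' A = Γ := by
  have hle : Config.instMeasurableSpace ≤ MeasurableSpace.comap Config.counts inferInstance := by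
    refine Config.instMeasurableSpace_le slab_mono iUnion_slab fun m B hB => ?_
    let B' : SlabSet := ⟨B ∩ slab m, hB.inter (measurableSet_slab m), m, inter_subset_right⟩
    exact (measurable_pi_apply B').comp (comap_measurable Config.counts)
  exact hle Γ hΓ

/-- Two measures on configurations agree as soon as they give the same weights to the values of
the counts in disjoint sets. It suffices to consider families of disjoint sets by which two given
sets are partitioned: the counts in arbitrary sets are sums of those in the atoms of the finite
algebra generated by them. -/
theorem Config.measure_ext {ν₁ ν₂ : Measure Config} [IsFiniteMeasure ν₂]
    (hf₁ : ∀ m, ∀ᵐ φ ∂ν₁, (φ.1 ∩ slab m).encard ≠ ⊤)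
    (hf₂ : ∀ m, ∀ᵐ φ ∂ν₂, (φ.1 ∩ slab m).encard ≠ ⊤) (A₁ A₂ : SlabSet)
    (h : ∀ (ι : Type) [Fintype ι] (C : ι → Set H3) (m : ℕ), (∀ i, MeasurableSet (C i)) →
      (∀ i, C i ⊆ slab m) → Pairwise (fun i j => Disjoint (C i) (C j)) →
      ∀ S₁ S₂ : Finset ι, A₁.1 = ⋃ i ∈ S₁, C i → A₂.1 = ⋃ i ∈ S₂, C i → ∀ k : ι → ℕ,
        ν₁ {φ | ∀ i, (φ.1 ∩ C i).encard = k i} = ν₂ {φ | ∀ i, (φ.1 ∩ C i).encard = k i}) :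
    ν₁ = ν₂ := by
  classical
  have hfin : ∀ I : Finset SlabSet,
      (ν₁.map Config.counts).map I.restrict = (ν₂.map Config.counts).map I.restrict := by
    intro I
    -- The cells `C s` are the nonempty atoms of the algebra generated by the sets in `J`.
    let J : Finset SlabSet := insert A₁ (insert A₂ I)
    let ι : Type := {s : Finset J // s.Nonempty}
    let C : ι → Set H3 := fun s => {x | ∀ i : J, x ∈ i.1.1 ↔ i ∈ s.1}
    obtain ⟨m, hm⟩ := exists_common_slab J (C := fun B => B.1) fun B _ => B.2.2
    have hCm : ∀ s, MeasurableSet (C s) := by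
      intro s
      have : C s = ⋂ i : J, {x | x ∈ i.1.1 ↔ i ∈ s.1} := by
        ext x
        simp only [C, mem_ofPred_eq, mem_iInter]
      rw [this]
      exact MeasurableSet.iInter fun i => MeasurableSet.iff i.1.2.1 (.const _)
    have hCs : ∀ s, C s ⊆ slab m := by
      rintro ⟨s, i, hi⟩ x hx
      exact hm i.1 i.2 ((hx i).2 hi)
    have hCd : Pairwise fun s t => Disjoint (C s) (C t) := by
      intro s t hst
      rw [Set.disjoint_left]
      intro x hs ht
      exact hst (Subtype.ext (Finset.ext fun i => (hs i).symm.trans (ht i)))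
    let S : SlabSet → Finset ι := fun B => Finset.univ.filter fun s => ∃ hB : B ∈ J, ⟨B, hB⟩ ∈ s.1
    have hBS : ∀ B ∈ J, B.1 = ⋃ s ∈ S B, C s := by
      intro B hB
      ext x
      simp only [S, mem_iUnion, Finset.mem_filter, Finset.mem_univ, true_and, exists_prop]
      constructor
      · intro hx
        let s : Finset J := Finset.univ.filter fun i => x ∈ i.1.1
        have hBs : (⟨B, hB⟩ : J) ∈ s := by simpa [s] using hx
        exact ⟨⟨s, _, hBs⟩, ⟨hB, hBs⟩, fun i => by simp [s]⟩
      · rintro ⟨s, ⟨hB', hs⟩, hx⟩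
        exact (hx ⟨B, hB'⟩).2 hs
    let V : Config → ι → ℕ := fun φ s => (φ.1 ∩ C s).encard.toNat
    have hV : Measurable V := measurable_pi_lambda _ fun s =>
      (Measurable.of_discrete (f := ENat.toNat)).comp (Config.measurable_encard (hCm s))
    have hVlaw : ν₁.map V = ν₂.map V := by
      rw [Measure.ext_iff_singleton]
      intro k
      have e : ∀ ν : Measure Config, (∀ᵐ φ ∂ν, (φ.1 ∩ slab m).encard ≠ ⊤) →
          ν.map V {k} = ν {φ | ∀ s, (φ.1 ∩ C s).encard = k s} := by
        intro ν hν
        rw [Measure.map_apply hV (.singleton _)]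
        refine measure_congr ?_
        filter_upwards [hν] with φ hφ
        refine propext ?_
        change V φ = k ↔ ∀ s, (φ.1 ∩ C s).encard = k s
        rw [funext_iff]
        refine forall_congr' fun s => ?_
        have hne : (φ.1 ∩ C s).encard ≠ ⊤ := ne_top_of_le_ne_top hφ
          (encard_le_encard (inter_subset_inter_right _ (hCs s)))
        constructor
        · intro h
          rw [← h, ENat.natCast_toNat hne]
        · intro h
          simp only [V, h, ENat.toNat_natCast]
      rw [e ν₁ (hf₁ m), e ν₂ (hf₂ m)]
      exact h ι C m hCm hCs hCd (S A₁) (S A₂) (hBS _ (by simp [J])) (hBS _ (by simp [J])) k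
    -- The counts in the sets of `I` are a fixed function of the counts in the cells.
    let W : (ι → ℕ) → I → ℕ∞ := fun n B => ∑ s ∈ S B.1, (n s : ℕ∞)
    have hW : Measurable W := measurable_of_countable _
    have e : ∀ ν : Measure Config, (∀ᵐ φ ∂ν, (φ.1 ∩ slab m).encard ≠ ⊤) →
        (ν.map Config.counts).map I.restrict = (ν.map V).map W := by
      intro ν hν
      rw [Measure.map_map (Finset.measurable_restrict I) Config.measurable_counts,
        Measure.map_map hW hV]
      refine Measure.map_congr ?_
      filter_upwards [hν] with φ hφ
      funext B
      have hBJ : B.1 ∈ J := by simp [J, B.2]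
      simp only [Function.comp_apply, Finset.restrict, Config.counts, W, V]
      rw [hBS B.1 hBJ, encard_inter_biUnion _ hCd]
      refine Finset.sum_congr rfl fun s _ => (ENat.natCast_toNat ?_).symm
      exact ne_top_of_le_ne_top hφ (encard_le_encard (inter_subset_inter_right _ (hCs s)))
    rw [e ν₁ (hf₁ m), e ν₂ (hf₂ m), hVlaw]
  have hc : ν₁.map Config.counts = ν₂.map Config.counts := by
    have h1 : IsProjectiveLimit (ν₁.map Config.counts)
        fun I => (ν₂.map Config.counts).map I.restrict := fun I => hfin I
    exact h1.unique fun I => rfl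
  ext Γ hΓ
  obtain ⟨A, hA, rfl⟩ := Config.exists_preimage_counts hΓ
  rw [← Measure.map_apply Config.measurable_counts hA, hc,
    Measure.map_apply Config.measurable_counts hA]

/-! ### The two-point Mecke formula -/

/-- A random configuration, enumerated by a sequence of random points, whose counts in disjoint
subsets of a slab are independent Poisson variables with intensity `Λ`. -/
structure IsSlabPoisson {Ω : Type*} [MeasurableSpace Ω] (P : Measure Ω) (Λ : Measure H3)
    (Φ : Ω → Config) : Prop where
  measurable : Measurable Φ
  slab_ne_top : ∀ m, Λ (slab m) ≠ ⊤
  singleton_eq_zero : ∀ a, Λ {a} = 0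
  exists_enum : ∃ Y : ℕ → Ω → H3, (∀ n, Measurable (Y n)) ∧
    ∀ᵐ ω ∂P, Function.Injective (fun n => Y n ω) ∧ (Φ ω).1 = range fun n => Y n ω
  ae_finite : ∀ m, ∀ᵐ ω ∂P, ((Φ ω).1 ∩ slab m).Finite
  count_law : ∀ (ι : Type) [Fintype ι] (C : ι → Set H3) (m : ℕ), (∀ i, MeasurableSet (C i)) →
    (∀ i, C i ⊆ slab m) → Pairwise (fun i j => Disjoint (C i) (C j)) → ∀ k : ι → ℕ,
    P {ω | ∀ i, ((Φ ω).1 ∩ C i).encard = k i} = ∏ i, poissonMeasure (Λ (C i)).toNNReal {k i}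

/-- Lower the `l`-th entry of a family of natural numbers by one. -/
def lowerAt {ι : Type*} [DecidableEq ι] (n : ι → ℕ) (l : ι) : ι → ℕ :=
  Function.update n l (n l - 1)

theorem natCast_mul_poissonMeasure (r : NNReal) (n : ℕ) :
    (n : ENNReal) * poissonMeasure r {n} =
      r * if n = 0 then 0 else poissonMeasure r {n - 1} := by
  cases n with
  | zero => simp
  | succ n =>
    rw [if_neg n.succ_ne_zero, Nat.add_sub_cancel, poissonMeasure_singleton,
      poissonMeasure_singleton, ← ENNReal.ofReal_natCast, ← ENNReal.ofReal_coe_nnreal,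
      ← ENNReal.ofReal_mul (by positivity), ← ENNReal.ofReal_mul (by positivity)]
    congr 1
    rw [Nat.factorial_succ]
    push_cast
    field_simp
    ring

/-- The one-point Mecke formula for a family of independent Poisson variables. -/
theorem natCast_mul_prod_poissonMeasure {ι : Type*} [Fintype ι] [DecidableEq ι] (r : ι → NNReal)
    (n : ι → ℕ) (l : ι) :
    (n l : ENNReal) * ∏ i, poissonMeasure (r i) {n i} =
      r l * if n l = 0 then 0 else ∏ i, poissonMeasure (r i) {lowerAt n l i} := by
  rw [← Finset.mul_prod_erase _ _ (Finset.mem_univ l), ← mul_assoc, natCast_mul_poissonMeasure]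
  split_ifs with h
  · simp
  · rw [mul_assoc, ← Finset.mul_prod_erase Finset.univ
      (fun i => poissonMeasure (r i) {lowerAt n l i}) (Finset.mem_univ l)]
    congr 2
    · simp [lowerAt]
    · refine Finset.prod_congr rfl fun i hi => ?_
      rw [lowerAt, Function.update_of_ne (Finset.ne_of_mem_erase hi)]

section Counts

variable {ι : Type*} [DecidableEq ι] {C : ι → Set H3}

theorem Config.encard_addPoint_eq_iff (hC : Pairwise fun i j => Disjoint (C i) (C j))
    {φ : Config} {a : H3} {l : ι} (hal : a ∈ C l) (ha : a ∉ φ.1) (n : ι → ℕ) :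
    (∀ i, ((φ.addPoint a).1 ∩ C i).encard = n i) ↔
      n l ≠ 0 ∧ ∀ i, (φ.1 ∩ C i).encard = lowerAt n l i := by
  classical
  have hl : ((φ.addPoint a).1 ∩ C l).encard = (φ.1 ∩ C l).encard + 1 := by
    rw [Config.encard_addPoint, if_pos ⟨hal, ha⟩]
  have hi : ∀ i ≠ l, ((φ.addPoint a).1 ∩ C i).encard = (φ.1 ∩ C i).encard := by
    intro i hi
    rw [Config.encard_addPoint, if_neg fun h => (hC hi).le_bot ⟨h.1, hal⟩]
  constructor
  · intro h
    have hl' := h l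
    rw [hl] at hl'
    have hn : n l ≠ 0 := by
      intro h0
      rw [h0, Nat.cast_zero] at hl'
      simp at hl'
    refine ⟨hn, fun i => ?_⟩
    by_cases hil : i = l
    · subst hil
      obtain ⟨k, hk⟩ := Nat.exists_eq_succ_of_ne_zero hn
      rw [lowerAt, Function.update_self, hk, Nat.succ_sub_one]
      rw [hk, Nat.cast_succ] at hl'
      exact ENat.add_left_injective_of_ne_top ENat.one_ne_top hl'
    · rw [lowerAt, Function.update_of_ne hil, ← hi i hil, h i]
  · rintro ⟨hn, h⟩ i
    by_cases hil : i = l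
    · subst hil
      obtain ⟨k, hk⟩ := Nat.exists_eq_succ_of_ne_zero hn
      rw [hl, h i, lowerAt, Function.update_self, hk, Nat.succ_sub_one, Nat.cast_succ]
    · rw [hi i hil, h i, lowerAt, Function.update_of_ne hil]

/-- The number of ordered pairs of distinct points with prescribed cells. -/
theorem count_offDiag_inter (hC : Pairwise fun i j => Disjoint (C i) (C j)) {s : Set H3}
    {n : ι → ℕ} (h : ∀ i, (s ∩ C i).encard = n i) (l k : ι) :
    Measure.count (s.offDiag ∩ C l ×ˢ C k) = (n l * lowerAt n l k : ℕ) := by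
  classical
  have hf : ∀ i, (s ∩ C i).Finite := fun i => by
    rw [← encard_ne_top_iff, h i]
    exact ENat.natCast_ne_top _
  have hcard : ∀ i, (hf i).toFinset.card = n i := by
    intro i
    have := h i
    rw [(hf i).encard_eq_coe_toFinset_card] at this
    exact_mod_cast this
  by_cases hlk : k = l
  · subst hlk
    have e : s.offDiag ∩ C k ×ˢ C k = ((hf k).toFinset.offDiag : Set (H3 × H3)) := by
      ext p
      simp only [Finset.coe_offDiag, Finite.coe_toFinset, mem_inter_iff, mem_offDiag, mem_prod]
      tauto
    rw [e, Measure.count_apply_finset, Finset.offDiag_card, hcard, lowerAt, Function.update_self,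
      Nat.mul_sub_one]
  · have e : s.offDiag ∩ C l ×ˢ C k
        = ((hf l).toFinset ×ˢ (hf k).toFinset : Finset (H3 × H3)) := by
      ext p
      simp only [Finset.coe_product, Finite.coe_toFinset, mem_inter_iff, mem_offDiag, mem_prod]
      constructor
      · tauto
      · rintro ⟨⟨h1, h2⟩, h3, h4⟩
        refine ⟨⟨h1, h3, fun he => ?_⟩, h2, h4⟩
        exact (hC hlk).le_bot ⟨h4, he ▸ h2⟩
    rw [e, Measure.count_apply_finset, Finset.card_product, hcard, hcard, lowerAt,
      Function.update_of_ne hlk]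

end Counts

section PairMeasure

variable {Ω : Type*} [MeasurableSpace Ω] {P : Measure Ω}

/-- The counting measure on pairs of distinct points is a sum of Dirac masses over an
enumeration. -/
theorem count_restrict_offDiag {α : Type*} [MeasurableSpace α] {y : ℕ → α}
    (hy : Function.Injective y) (hm : MeasurableSet (range y).offDiag) :
    Measure.count.restrict (range y).offDiag =
      Measure.sum fun ij : {ij : ℕ × ℕ // ij.1 ≠ ij.2} => Measure.dirac (y ij.1.1, y ij.1.2) := by
  let g : {ij : ℕ × ℕ // ij.1 ≠ ij.2} → α × α := fun ij => (y ij.1.1, y ij.1.2)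
  have hg : Function.Injective g := by
    rintro ⟨⟨i, j⟩, _⟩ ⟨⟨i', j'⟩, _⟩ h
    have h' := Prod.ext_iff.1 h
    exact Subtype.ext (Prod.ext (hy h'.1) (hy h'.2))
  have hr : (range y).offDiag = range g := by
    ext ⟨a, b⟩
    simp only [mem_offDiag, mem_range]
    constructor
    · rintro ⟨⟨i, rfl⟩, ⟨j, rfl⟩, hij⟩
      exact ⟨⟨(i, j), fun h => hij (congrArg y h)⟩, rfl⟩
    · rintro ⟨⟨⟨i, j⟩, hij⟩, h⟩
      have h' := Prod.ext_iff.1 h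
      refine ⟨⟨i, h'.1⟩, ⟨j, h'.2⟩, fun hab => hij (hy ?_)⟩
      exact h'.1.trans (hab.trans h'.2.symm)
  ext A hA
  rw [Measure.restrict_apply hA, Measure.sum_apply _ hA, Measure.count,
    Measure.sum_apply _ (hA.inter hm)]
  simp only [Measure.dirac_apply' _ hA, Measure.dirac_apply' _ (hA.inter hm)]
  rw [← hg.tsum_eq]
  · refine tsum_congr fun ij => ?_
    have : g ij ∈ (range y).offDiag := hr ▸ mem_range_self ij
    by_cases h : g ij ∈ A
    · rw [indicator_of_mem (show g ij ∈ A ∩ (range y).offDiag from ⟨h, this⟩),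
        indicator_of_mem (show (y ij.1.1, y ij.1.2) ∈ A from h)]
    · rw [indicator_of_notMem (fun h' : g ij ∈ A ∩ (range y).offDiag => h h'.1),
        indicator_of_notMem (show (y ij.1.1, y ij.1.2) ∉ A from h)]
  · intro p hp
    rw [Function.mem_support] at hp
    rw [← hr]
    exact (mem_of_indicator_ne_zero hp).2

theorem Config.measurableSet_offDiag (φ : Config) : MeasurableSet φ.1.offDiag :=
  ((φ.countable.prod φ.countable).mono (offDiag_subset_prod _)).measurableSet

namespace IsSlabPoisson

variable {Λ : Measure H3} {Φ : Ω → Config}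

/-- The measurability that makes `secondFactorialMoment` a genuine mixture: `Measure.bind` needs it
in order not to take a junk value. -/
theorem aemeasurable_count_restrict (h : IsSlabPoisson P Λ Φ) :
    AEMeasurable (fun ω => (Measure.count.restrict (Φ ω).1.offDiag : Measure (H3 × H3))) P := by
  obtain ⟨Y, hY, hae⟩ := h.exists_enum
  refine ⟨fun ω => Measure.sum fun ij : {ij : ℕ × ℕ // ij.1 ≠ ij.2} =>
    Measure.dirac (Y ij.1.1 ω, Y ij.1.2 ω), ?_, ?_⟩
  · refine Measure.measurable_of_measurable_coe _ fun A hA => ?_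
    simp only [Measure.sum_apply _ hA]
    refine Measurable.tsum fun ij => ?_
    exact (Measure.measurable_coe hA).comp
      (Measure.measurable_dirac.comp ((hY ij.1.1).prodMk (hY ij.1.2)))
  · filter_upwards [hae] with ω hω
    have hm := (Φ ω).measurableSet_offDiag
    rw [hω.2] at hm ⊢
    exact count_restrict_offDiag hω.1 hm

theorem aemeasurable_count (h : IsSlabPoisson P Λ Φ) {A : Set (H3 × H3)} (hA : MeasurableSet A) :
    AEMeasurable (fun ω => Measure.count ((Φ ω).1.offDiag ∩ A)) P := by
  have := (Measure.measurable_coe hA).comp_aemeasurable h.aemeasurable_count_restrict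
  refine this.congr (.of_forall fun ω => ?_)
  simp only [Function.comp_apply]
  rw [Measure.restrict_apply hA, inter_comm]

theorem measurable_addPair (h : IsSlabPoisson P Λ Φ) (a b : H3) :
    Measurable fun ω => (Φ ω).addPair a b :=
  Config.measurable_addPair.comp (f := fun ω => ((a, b), Φ ω))
    (measurable_const.prodMk h.measurable)

variable [IsProbabilityMeasure P]

theorem ae_notMem (h : IsSlabPoisson P Λ Φ) (a : H3) : ∀ᵐ ω ∂P, a ∉ (Φ ω).1 := by
  obtain ⟨m, hm⟩ := mem_iUnion.1 (iUnion_slab ▸ mem_univ a)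
  have hlaw := h.count_law Unit (fun _ => {a}) m (fun _ => .singleton a)
    (fun _ => singleton_subset_iff.2 hm) (fun i j hij => (hij (Subsingleton.elim i j)).elim)
    (fun _ => 0)
  have h1 : P {ω | ((Φ ω).1 ∩ {a}).encard = 0} = 1 := by
    simpa [h.singleton_eq_zero, poissonMeasure_singleton] using hlaw
  have hms : MeasurableSet {ω | ((Φ ω).1 ∩ {a}).encard = 0} :=
    ((Config.measurable_encard (.singleton a)).comp h.measurable) (t := {0}) .of_discrete
  have h2 := (mem_ae_iff_prob_eq_one hms).2 h1
  filter_upwards [h2] with ω hω ha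
  have : (Φ ω).1 ∩ {a} = ∅ := encard_eq_zero.1 hω
  exact this.le ⟨ha, rfl⟩

/-- The law of `Φ` with two points added, as a kernel. -/
noncomputable def palm (h : IsSlabPoisson P Λ Φ) : Kernel (H3 × H3) Config where
  toFun p := P.map fun ω => (Φ ω).addPair p.1 p.2
  measurable' := by
    refine Measure.measurable_of_measurable_coe _ fun Γ hΓ => ?_
    have hm : Measurable fun q : (H3 × H3) × Ω => (Φ q.2).addPair q.1.1 q.1.2 :=
      Config.measurable_addPair.comp
        (measurable_fst.prodMk (h.measurable.comp measurable_snd))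
    have e : (fun p : H3 × H3 => P.map (fun ω => (Φ ω).addPair p.1 p.2) Γ)
        = fun p => P (Prod.mk p ⁻¹' ((fun q : (H3 × H3) × Ω =>
          (Φ q.2).addPair q.1.1 q.1.2) ⁻¹' Γ)) := by
      funext p
      exact Measure.map_apply (hm.comp measurable_prodMk_left) hΓ
    rw [e]
    exact measurable_measure_prodMk_left (hm hΓ)

theorem palm_apply (h : IsSlabPoisson P Λ Φ) (a b : H3) :
    h.palm (a, b) = P.map fun ω => (Φ ω).addPair a b := rfl

instance isMarkovKernel_palm (h : IsSlabPoisson P Λ Φ) : IsMarkovKernel h.palm :=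
  ⟨fun p => Measure.isProbabilityMeasure_map (h.measurable_addPair p.1 p.2).aemeasurable⟩

/-- The Palm probability of prescribed counts. Adding `a` and `b` lowers the required counts of
`Φ` by one in the cells of `a` and of `b`. -/
theorem palm_counts (h : IsSlabPoisson P Λ Φ) {ι : Type} [Fintype ι] [DecidableEq ι]
    {C : ι → Set H3} {m : ℕ} (hCm : ∀ i, MeasurableSet (C i)) (hCs : ∀ i, C i ⊆ slab m)
    (hCd : Pairwise fun i j => Disjoint (C i) (C j)) (n : ι → ℕ) {l k : ι} {a b : H3}
    (ha : a ∈ C l) (hb : b ∈ C k) (hab : a ≠ b) :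
    h.palm (a, b) {φ | ∀ i, (φ.1 ∩ C i).encard = n i} =
      if n l = 0 then 0 else if lowerAt n l k = 0 then 0 else
        ∏ i, poissonMeasure (Λ (C i)).toNNReal {lowerAt (lowerAt n l) k i} := by
  have hm : MeasurableSet {φ : Config | ∀ i, (φ.1 ∩ C i).encard = n i} := by
    have : {φ : Config | ∀ i, (φ.1 ∩ C i).encard = n i}
        = ⋂ i, {φ : Config | (φ.1 ∩ C i).encard = n i} := by
      ext φ
      simp only [mem_ofPred_eq, mem_iInter]
    rw [this]
    exact .iInter fun i => Config.measurable_encard (hCm i) (t := {(n i : ℕ∞)}) .of_discrete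
  rw [palm_apply, Measure.map_apply (h.measurable_addPair a b) hm]
  have hiff : ∀ᵐ ω ∂P, (∀ i, (((Φ ω).addPair a b).1 ∩ C i).encard = n i) ↔
      n l ≠ 0 ∧ lowerAt n l k ≠ 0 ∧
        ∀ i, ((Φ ω).1 ∩ C i).encard = lowerAt (lowerAt n l) k i := by
    filter_upwards [h.ae_notMem a, h.ae_notMem b] with ω hωa hωb
    rw [Config.addPair_eq, Config.encard_addPoint_eq_iff hCd ha,
      Config.encard_addPoint_eq_iff hCd hb hωb]
    rintro (rfl | h')
    · exact hab rfl
    · exact hωa h'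
  split_ifs with h1 h2
  · refine measure_mono_null_ae (t := ∅) ?_ measure_empty
    filter_upwards [hiff] with ω hω hω'
    exact (hω.1 hω').1 h1
  · refine measure_mono_null_ae (t := ∅) ?_ measure_empty
    filter_upwards [hiff] with ω hω hω'
    exact (hω.1 hω').2.1 h2
  · rw [← h.count_law ι C m hCm hCs hCd]
    refine measure_congr ?_
    filter_upwards [hiff] with ω hω
    refine propext (hω.trans ?_)
    simp only [Ne, h1, h2, not_false_eq_true, true_and]
    rfl

end IsSlabPoisson

end PairMeasure

namespace IsSlabPoisson

variable {Ω : Type*} [MeasurableSpace Ω] {P : Measure Ω} {Λ : Measure H3} {Φ : Ω → Config}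

theorem sigmaFinite (h : IsSlabPoisson P Λ Φ) : SigmaFinite Λ :=
  ⟨⟨{ set := slab
      set_mem := fun _ => trivial
      finite := fun m => (h.slab_ne_top m).lt_top
      spanning := iUnion_slab }⟩⟩

theorem ae_ne (h : IsSlabPoisson P Λ Φ) [SFinite Λ] : ∀ᵐ p ∂Λ.prod Λ, p.1 ≠ p.2 := by
  have hd : MeasurableSet {p : H3 × H3 | p.1 = p.2} :=
    measurableSet_eq_fun measurable_fst measurable_snd
  have h0 : (Λ.prod Λ) {p : H3 × H3 | p.1 = p.2} = 0 := by
    rw [Measure.measure_prod_null hd]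
    refine .of_forall fun a => ?_
    refine measure_mono_null (fun b hb => ?_) (h.singleton_eq_zero a)
    exact (show a = b from hb).symm
  filter_upwards [compl_mem_ae_iff.2 h0] with p hp
  exact hp

variable [IsProbabilityMeasure P]

/-- The Mecke formula for a pair of cells and the event that prescribes all counts. -/
theorem mecke_cell (h : IsSlabPoisson P Λ Φ) [SFinite Λ] {ι : Type} [Fintype ι] [DecidableEq ι]
    {C : ι → Set H3} {m : ℕ} (hCm : ∀ i, MeasurableSet (C i)) (hCs : ∀ i, C i ⊆ slab m)
    (hCd : Pairwise fun i j => Disjoint (C i) (C j)) (n : ι → ℕ) (l k : ι) :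
    ∫⁻ p in C l ×ˢ C k, h.palm p {φ | ∀ i, (φ.1 ∩ C i).encard = n i} ∂(Λ.prod Λ) =
      (n l * lowerAt n l k : ℕ) * P {ω | ∀ i, ((Φ ω).1 ∩ C i).encard = n i} := by
  have hΛ : ∀ i, ((Λ (C i)).toNNReal : ENNReal) = Λ (C i) := fun i =>
    ENNReal.coe_toNNReal (ne_top_of_le_ne_top (h.slab_ne_top m) (measure_mono (hCs i)))
  have e : ∫⁻ p in C l ×ˢ C k, h.palm p {φ | ∀ i, (φ.1 ∩ C i).encard = n i} ∂(Λ.prod Λ) =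
      ∫⁻ _ in C l ×ˢ C k, (if n l = 0 then 0 else if lowerAt n l k = 0 then 0 else
        ∏ i, poissonMeasure (Λ (C i)).toNNReal {lowerAt (lowerAt n l) k i}) ∂(Λ.prod Λ) := by
    refine lintegral_congr_ae ?_
    filter_upwards [ae_restrict_mem ((hCm l).prod (hCm k)), ae_restrict_of_ae h.ae_ne]
      with p hp hne
    exact h.palm_counts hCm hCs hCd n hp.1 hp.2 hne
  rw [e, setLIntegral_const, Measure.prod_prod, h.count_law ι C m hCm hCs hCd, Nat.cast_mul,
    mul_comm (n l : ENNReal), mul_assoc, natCast_mul_prod_poissonMeasure, hΛ l]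
  split_ifs with h1 h2
  · simp
  · rw [mul_left_comm (lowerAt n l k : ENNReal), natCast_mul_prod_poissonMeasure, hΛ k, if_pos h2]
    simp
  · rw [mul_left_comm (lowerAt n l k : ENNReal), natCast_mul_prod_poissonMeasure, hΛ k,
      if_neg h2]
    ring

/-- The Mecke formula for a rectangle with sides contained in slabs and an arbitrary event. Both sides are
measures of the event; they agree on the events that prescribe the counts in a family of cells
that partitions both sides of the rectangle. -/
theorem mecke_slab (h : IsSlabPoisson P Λ Φ) [SFinite Λ] (A₁ A₂ : SlabSet) {Γ : Set Config}
    (hΓ : MeasurableSet Γ) :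
    ∫⁻ ω in Φ ⁻¹' Γ, Measure.count ((Φ ω).1.offDiag ∩ A₁.1 ×ˢ A₂.1) ∂P =
      ∫⁻ p in A₁.1 ×ˢ A₂.1, h.palm p Γ ∂(Λ.prod Λ) := by
  classical
  have hA : MeasurableSet (A₁.1 ×ˢ A₂.1) := A₁.2.1.prod A₂.2.1
  have hc := h.aemeasurable_count hA
  let ν₁ : Measure Config :=
    (P.withDensity fun ω => Measure.count ((Φ ω).1.offDiag ∩ A₁.1 ×ˢ A₂.1)).map Φ
  let ν₂ : Measure Config := ((Λ.prod Λ).restrict (A₁.1 ×ˢ A₂.1)).bind h.palm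
  have hν₁ : ∀ Γ, MeasurableSet Γ → ν₁ Γ =
      ∫⁻ ω in Φ ⁻¹' Γ, Measure.count ((Φ ω).1.offDiag ∩ A₁.1 ×ˢ A₂.1) ∂P := fun Γ hΓ => by
    rw [Measure.map_apply h.measurable hΓ, withDensity_apply _ (h.measurable hΓ)]
  have hν₂ : ∀ Γ, MeasurableSet Γ → ν₂ Γ = ∫⁻ p in A₁.1 ×ˢ A₂.1, h.palm p Γ ∂(Λ.prod Λ) :=
    fun Γ hΓ => Measure.bind_apply hΓ h.palm.measurable.aemeasurable
  have hslab : ∀ A : SlabSet, Λ A.1 < ⊤ := by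
    rintro ⟨A, hA, m, hm⟩
    exact (measure_mono hm).trans_lt (h.slab_ne_top m).lt_top
  have hfin : IsFiniteMeasure ν₂ := ⟨by
    rw [hν₂ _ .univ]
    simp only [measure_univ, setLIntegral_one, Measure.prod_prod]
    exact ENNReal.mul_lt_top (hslab A₁) (hslab A₂)⟩
  have hm : ∀ m, MeasurableSet {φ : Config | (φ.1 ∩ slab m).encard ≠ ⊤} := fun m =>
    Config.measurable_encard (measurableSet_slab m) (t := {⊤}ᶜ) .of_discrete
  suffices hν : ν₁ = ν₂ by rw [← hν₁ Γ hΓ, ← hν₂ Γ hΓ, hν]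
  refine Config.measure_ext (fun m => ?_) (fun m => ?_) A₁ A₂ ?_
  · rw [ae_map_iff h.measurable.aemeasurable (hm m)]
    refine (withDensity_absolutelyContinuous P _).ae_le ?_
    filter_upwards [h.ae_finite m] with ω hω
    exact encard_ne_top_iff.2 hω
  · rw [ae_iff]
    have : {φ : Config | ¬(φ.1 ∩ slab m).encard ≠ ⊤} = {φ | (φ.1 ∩ slab m).encard ≠ ⊤}ᶜ := rfl
    rw [this, hν₂ _ (hm m).compl]
    refine (lintegral_congr fun p => ?_).trans lintegral_zero
    have hp : h.palm p = P.map fun ω => (Φ ω).addPair p.1 p.2 := rfl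
    rw [hp, Measure.map_apply (h.measurable_addPair _ _) (hm m).compl]
    have hae := h.ae_finite m
    refine measure_mono_null (fun ω hω => ?_) (ae_iff.1 hae)
    intro hf
    refine hω (encard_ne_top_iff.2 (((hf.insert p.2).insert p.1).subset ?_))
    rintro x ⟨rfl | rfl | hx, hK⟩
    · exact Or.inl rfl
    · exact Or.inr (Or.inl rfl)
    · exact Or.inr (Or.inr ⟨hx, hK⟩)
  · intro ι _ C m hCm hCs hCd S₁ S₂ hS₁ hS₂ n
    have hE : MeasurableSet {φ : Config | ∀ i, (φ.1 ∩ C i).encard = n i} := by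
      have : {φ : Config | ∀ i, (φ.1 ∩ C i).encard = n i}
          = ⋂ i, {φ : Config | (φ.1 ∩ C i).encard = n i} := by
        ext φ
        simp only [mem_ofPred_eq, mem_iInter]
      rw [this]
      exact .iInter fun i => Config.measurable_encard (hCm i) (t := {(n i : ℕ∞)}) .of_discrete
    have hU : A₁.1 ×ˢ A₂.1 = ⋃ q ∈ S₁ ×ˢ S₂, C q.1 ×ˢ C q.2 := by
      rw [hS₁, hS₂]
      ext p
      simp only [mem_prod, mem_iUnion, Finset.mem_product, exists_prop, Prod.exists]
      constructor
      · rintro ⟨⟨i, hi, hp⟩, j, hj, hp'⟩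
        exact ⟨i, j, ⟨hi, hj⟩, hp, hp'⟩
      · rintro ⟨i, j, ⟨hi, hj⟩, hp, hp'⟩
        exact ⟨⟨i, hi, hp⟩, j, hj, hp'⟩
    have hdisj : Pairwise fun q q' : ι × ι => Disjoint (C q.1 ×ˢ C q.2) (C q'.1 ×ˢ C q'.2) := by
      intro q q' hq
      rw [Set.disjoint_left]
      rintro p ⟨h1, h2⟩ ⟨h1', h2'⟩
      refine hq (Prod.ext ?_ ?_)
      · by_contra hne
        exact (hCd hne).le_bot ⟨h1, h1'⟩
      · by_contra hne
        exact (hCd hne).le_bot ⟨h2, h2'⟩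
    have hqm : ∀ q : ι × ι, MeasurableSet (C q.1 ×ˢ C q.2) := fun q => (hCm q.1).prod (hCm q.2)
    rw [hν₁ _ hE, hν₂ _ hE, hU, lintegral_biUnion_finset (fun q _ q' _ hq => hdisj hq)
      (fun q _ => hqm q)]
    simp only [h.mecke_cell hCm hCs hCd n]
    rw [← Finset.sum_mul, ← setLIntegral_const]
    refine setLIntegral_congr_fun (h.measurable hE) fun ω hω => ?_
    rw [inter_iUnion₂, measure_biUnion_finset]
    · exact Finset.sum_congr rfl fun q _ => count_offDiag_inter hCd hω q.1 q.2
    · exact fun q _ q' _ hq => (hdisj hq).mono inter_subset_right inter_subset_right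
    · exact fun q _ => (Φ ω).measurableSet_offDiag.inter (hqm q)

end IsSlabPoisson

theorem generateFrom_slabSets :
    MeasurableSpace.generateFrom {C : Set H3 | MeasurableSet C ∧ ∃ m, C ⊆ slab m} =
      (inferInstance : MeasurableSpace H3) := by
  refine le_antisymm (MeasurableSpace.generateFrom_le fun C hC => hC.1) fun B hB => ?_
  rw [← inter_univ B, ← iUnion_slab, inter_iUnion]
  refine MeasurableSet.iUnion fun m => ?_
  exact MeasurableSpace.measurableSet_generateFrom
    ⟨MeasurableSet.inter hB (measurableSet_slab m), m, inter_subset_right⟩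

theorem slab_mem_slabSets (m : ℕ) :
    slab m ∈ {C : Set H3 | MeasurableSet C ∧ ∃ m, C ⊆ slab m} :=
  ⟨measurableSet_slab m, m, subset_rfl⟩

theorem isPiSystem_slabSets : IsPiSystem {C : Set H3 | MeasurableSet C ∧ ∃ m, C ⊆ slab m} := by
  rintro s ⟨hs, m, hm⟩ t ⟨ht, -⟩ -
  exact ⟨hs.inter ht, m, inter_subset_left.trans hm⟩

namespace IsSlabPoisson

variable {Ω : Type*} [MeasurableSpace Ω] {P : Measure Ω} [IsProbabilityMeasure P]
  {Λ : Measure H3} {Φ : Ω → Config}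

/-- The two-point Mecke formula. Both sides are measures of the set `A` of pairs, finite on
rectangles with sides contained in slabs, so the case of rectangles suffices. -/
theorem mecke (h : IsSlabPoisson P Λ Φ) [SFinite Λ] {A : Set (H3 × H3)} (hA : MeasurableSet A)
    {Γ : Set Config} (hΓ : MeasurableSet Γ) :
    ∫⁻ ω in Φ ⁻¹' Γ, Measure.count ((Φ ω).1.offDiag ∩ A) ∂P =
      ∫⁻ p in A, h.palm p Γ ∂(Λ.prod Λ) := by
  let m₁ : Measure (H3 × H3) :=
    (P.restrict (Φ ⁻¹' Γ)).bind fun ω => Measure.count.restrict (Φ ω).1.offDiag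
  let m₂ : Measure (H3 × H3) := (Λ.prod Λ).withDensity fun p => h.palm p Γ
  have hm₁ : ∀ A, MeasurableSet A →
      m₁ A = ∫⁻ ω in Φ ⁻¹' Γ, Measure.count ((Φ ω).1.offDiag ∩ A) ∂P := by
    intro A hA
    rw [Measure.bind_apply hA h.aemeasurable_count_restrict.restrict]
    refine lintegral_congr fun ω => ?_
    rw [Measure.restrict_apply hA, inter_comm]
  have hm₂ : ∀ A, MeasurableSet A → m₂ A = ∫⁻ p in A, h.palm p Γ ∂(Λ.prod Λ) :=
    fun A hA => withDensity_apply _ hA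
  have hrect : ∀ A₁ A₂ : SlabSet, m₁ (A₁.1 ×ˢ A₂.1) = m₂ (A₁.1 ×ˢ A₂.1) := fun A₁ A₂ => by
    rw [hm₁ _ (A₁.2.1.prod A₂.2.1), hm₂ _ (A₁.2.1.prod A₂.2.1), h.mecke_slab A₁ A₂ hΓ]
  have hspan : IsCountablySpanning {C : Set H3 | MeasurableSet C ∧ ∃ m, C ⊆ slab m} :=
    ⟨slab, slab_mem_slabSets, iUnion_slab⟩
  have hm : m₁ = m₂ := by
    refine Measure.ext_of_generateFrom_of_iUnion _ (fun n => slab n ×ˢ slab n)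
      (generateFrom_eq_prod generateFrom_slabSets generateFrom_slabSets hspan hspan).symm
      (isPiSystem_slabSets.prod isPiSystem_slabSets) ?_ (fun n => ?_) (fun n => ?_) ?_
    · refine eq_univ_of_forall fun p => ?_
      obtain ⟨i, hi⟩ := mem_iUnion.1 (iUnion_slab ▸ mem_univ p.1)
      obtain ⟨j, hj⟩ := mem_iUnion.1 (iUnion_slab ▸ mem_univ p.2)
      exact mem_iUnion.2 ⟨max i j, slab_mono (le_max_left i j) hi, slab_mono (le_max_right i j) hj⟩
    · exact ⟨_, slab_mem_slabSets n, _, slab_mem_slabSets n, rfl⟩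
    · rw [hrect ⟨slab n, slab_mem_slabSets n⟩ ⟨slab n, slab_mem_slabSets n⟩,
        hm₂ _ ((measurableSet_slab n).prod (measurableSet_slab n))]
      refine ne_top_of_le_ne_top (ENNReal.mul_ne_top (h.slab_ne_top n) (h.slab_ne_top n)) ?_
      rw [← Measure.prod_prod, ← setLIntegral_one]
      exact lintegral_mono fun p => prob_le_one
    · rintro _ ⟨A₁, hA₁, A₂, hA₂, rfl⟩
      exact hrect ⟨A₁, hA₁⟩ ⟨A₂, hA₂⟩
  rw [← hm₁ A hA, hm, hm₂ A hA]

theorem secondFactorialMoment_eq (h : IsSlabPoisson P Λ Φ) [SFinite Λ] :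
    secondFactorialMoment P Φ = Λ.prod Λ := by
  ext A hA
  rw [secondFactorialMoment, Measure.bind_apply hA h.aemeasurable_count_restrict]
  have := h.mecke hA .univ
  simp only [preimage_univ, Measure.restrict_univ, measure_univ, setLIntegral_one] at this
  rw [← this]
  refine lintegral_congr fun ω => ?_
  rw [Measure.restrict_apply hA, inter_comm]

/-- Slivnyak's theorem: adding the two points gives a version of the two-fold Palm measure. -/
theorem isTwoFoldPalm_palm (h : IsSlabPoisson P Λ Φ) [SFinite Λ] : IsTwoFoldPalm P Φ h.palm where
  isMarkov := inferInstance
  disintegration A Γ hA hΓ := by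
    rw [h.secondFactorialMoment_eq]
    exact h.mecke hA hΓ

/-- Two versions of the Palm measures agree almost everywhere, because the sigma-algebra of
configurations is countably generated. -/
theorem ae_eq_palm (h : IsSlabPoisson P Λ Φ) [SigmaFinite Λ] {κ : Kernel (H3 × H3) Config}
    (hκ : IsTwoFoldPalm P Φ κ) : ∀ᵐ p ∂Λ.prod Λ, κ p = h.palm p := by
  have := hκ.isMarkov
  obtain ⟨Q, hQc, hQg, hQπ⟩ := Config.countablyGenerated
  have hQm : ∀ Γ ∈ Q, MeasurableSet Γ := fun Γ hΓ => by
    have hm : MeasurableSet[MeasurableSpace.generateFrom Q] Γ :=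
      MeasurableSpace.measurableSet_generateFrom hΓ
    rwa [← hQg] at hm
  have hae : ∀ᵐ p ∂Λ.prod Λ, ∀ Γ ∈ Q, κ p Γ = h.palm p Γ := by
    rw [ae_ball_iff hQc]
    intro Γ hΓ
    refine ae_eq_of_forall_setLIntegral_eq_of_sigmaFinite
      (κ.measurable_coe (hQm Γ hΓ)) (h.palm.measurable_coe (hQm Γ hΓ)) fun A hA _ => ?_
    rw [← h.mecke hA (hQm Γ hΓ), hκ.disintegration A Γ hA (hQm Γ hΓ), h.secondFactorialMoment_eq]
  filter_upwards [hae] with p hp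
  exact ext_of_generate_finite Q hQg hQπ hp (by rw [measure_univ, measure_univ])

end IsSlabPoisson

/-! ### The marked Poisson process in slabs -/

theorem isSlabPoisson_of_isMarkedPPP {Ω : Type*} [MeasurableSpace Ω] {P : Measure Ω}
    [IsProbabilityMeasure P] {lam : ℝ} {f : ℝ → ℝ}
    (h1 : ∫⁻ z in Ioi (0 : ℝ), ENNReal.ofReal (f z) = 1) {Φ : Ω → Config} (hΦm : Measurable Φ)
    (hΦ : IsMarkedPPP P lam f Φ) : IsSlabPoisson P (intensity lam f) Φ := by
  have := isProbabilityMeasure_markLaw h1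
  obtain ⟨X, Z, hX, hZ, hinj, hS, hpp, hlaw, hind, hXZ⟩ := hΦ
  have hball : ∀ m : ℕ, (ENNReal.ofReal lam • (volume : Measure Plane)) (Metric.ball 0 m) ≠ ⊤ :=
    fun m => by
      rw [Measure.smul_apply, smul_eq_mul]
      exact ENNReal.mul_ne_top ENNReal.ofReal_ne_top measure_ball_lt_top.ne
  refine ⟨hΦm, fun m => ?_, fun a => ?_, ⟨fun n ω => (X n ω, Z n ω), fun n => ?_, ?_⟩,
    fun m => ?_, fun ι _ C m hC hCs hCd k => ?_⟩
  · rw [intensity, slab, Measure.prod_prod, measure_univ, mul_one]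
    exact hball m
  · refine measure_mono_null (t := ({a.1} : Set Plane) ×ˢ univ) (fun x hx => ?_) ?_
    · rw [mem_singleton_iff.1 hx]
      exact ⟨rfl, mem_univ _⟩
    · rw [intensity, Measure.prod_prod, Measure.smul_apply, measure_singleton]
      simp
  · exact (hX n).prodMk (hZ n)
  · filter_upwards [hinj, hS] with ω h2 h3
    exact ⟨injective_marked h2 _, h3⟩
  · filter_upwards [hinj, hS, hpp.ae_finite measurableSet_ball (hball m)] with ω h2 h3 h4
    rw [h3, slab]
    exact finite_marked h2 _ h4
  · exact hpp.count_marked hX hZ hinj hlaw hind hXZ hS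
      (fun C hC => (Config.measurable_encard hC).comp hΦm) measurableSet_ball (hball m) hC hCd hCs k

/-! ### The region that has to be empty -/

/-- The points, other than `a` and `b`, that prevent `a` and `b` from being mutually nearest
neighbours. The balls are closed because nearest neighbours are required to be unique. -/
def blockers (a b : H3) : Set H3 :=
  {c | c ≠ a ∧ c ≠ b ∧ (dH a c ≤ dH a b ∨ dH b c ≤ dH a b)}

theorem mnnr_iff {φ : Set H3} {D : Set (ℝ × ℝ)} {a b : H3} (hab : a ≠ b) :
    MNNR φ D a b ↔
      ((a.2 : ℝ), (b.2 : ℝ)) ∈ D ∧ a ∈ φ ∧ b ∈ φ ∧ φ ∩ blockers a b = ∅ := by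
  have hba : dH b a = dH a b := dH_comm b a
  constructor
  · rintro ⟨⟨ha, hb, h1⟩, ⟨-, -, h2⟩, hD⟩
    refine ⟨hD, ha, hb.1, eq_empty_of_forall_notMem ?_⟩
    rintro c ⟨hc, hca, hcb, h | h⟩
    · exact (h1 c ⟨hc, hca⟩ hcb).not_ge h
    · exact (h2 c ⟨hc, hcb⟩ hca).not_ge (hba ▸ h)
  · rintro ⟨hD, ha, hb, h⟩
    have hQ : ∀ c ∈ φ, c ≠ a → c ≠ b → dH a b < dH a c ∧ dH a b < dH b c := by
      intro c hc hca hcb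
      by_contra hn
      rw [not_and_or, not_lt, not_lt] at hn
      exact (h ▸ (⟨hc, hca, hcb, hn⟩ : c ∈ φ ∩ blockers a b) : c ∈ (∅ : Set H3))
    exact ⟨⟨ha, ⟨hb, hab.symm⟩, fun c hc hcb => (hQ c hc.1 hc.2 hcb).1⟩,
      ⟨hb, ⟨ha, hab⟩, fun c hc hca => hba ▸ (hQ c hc.1 hca hc.2).2⟩, hD⟩

theorem measurableSet_dH_le {ε : ℝ} (hε : 0 ≤ ε) (a : H3) : MeasurableSet {c | dH a c ≤ ε} := by
  simp only [(cmp_dH hε a _).2]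
  exact measurableSet_le (by fun_prop) (by fun_prop)

theorem measurableSet_blockers (a b : H3) : MeasurableSet (blockers a b) :=
  (measurableSet_singleton a).compl.inter ((measurableSet_singleton b).compl.inter
    ((measurableSet_dH_le (dH_nonneg a b) a).union (measurableSet_dH_le (dH_nonneg a b) b)))

theorem exists_blockers_subset_slab (a b : H3) : ∃ m, blockers a b ⊆ slab m := by
  have hS : 0 ≤ Real.sinh (dH a b) := Real.sinh_nonneg_iff.2 (dH_nonneg a b)
  have hB : ∀ a' c : H3, dH a' c ≤ dH a b → ‖c.1‖ ≤ ‖a'.1‖ + a'.2 * Real.sinh (dH a b) := by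
    intro a' c hc
    have h1 : dist a'.1 c.1 ≤ a'.2 * Real.sinh (dH a b) :=
      by
      refine (le_abs_self _).trans (abs_le_of_sq_le_sq
        (le_trans ?_ ((cmp_dH (dH_nonneg a b) a' c).2.1 hc)) (mul_nonneg (le_of_lt a'.2.2) hS))
      exact le_add_of_nonneg_right (sq_nonneg _)
    rw [dist_eq_norm'] at h1
    linarith [norm_le_norm_add_norm_sub' c.1 a'.1]
  obtain ⟨m, hm⟩ := exists_nat_gt (max (‖a.1‖ + a.2 * Real.sinh (dH a b))
    (‖b.1‖ + b.2 * Real.sinh (dH a b)))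
  refine ⟨m, ?_⟩
  rintro c ⟨-, -, h | h⟩ <;> refine ⟨mem_ball_zero_iff.2 ((hB _ c h).trans_lt ?_), mem_univ _⟩
  · exact (le_max_left _ _).trans_lt hm
  · exact (le_max_right _ _).trans_lt hm

/-- Hyperbolic spheres are null sets of the intensity measure: their horizontal sections are
circles. -/
theorem intensity_sphere {f : ℝ → ℝ} (h1 : ∫⁻ z in Ioi (0 : ℝ), ENNReal.ofReal (f z) = 1)
    (lam : ℝ) {ε : ℝ} (hε : 0 ≤ ε) (a : H3) : intensity lam f {c | dH a c = ε} = 0 := by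
  have := isProbabilityMeasure_markLaw h1
  have heq : {c | dH a c = ε} = {c : H3 | dist a.1 c.1 ^ 2 + ((c.2 : ℝ) - a.2 * Real.cosh ε) ^ 2
      = (a.2 * Real.sinh ε) ^ 2} := by
    ext c
    rw [mem_ofPred_eq, mem_ofPred_eq, eq_iff_le_not_lt, eq_iff_le_not_lt, (cmp_dH hε a c).1,
      (cmp_dH hε a c).2]
  have hm : MeasurableSet {c : H3 | dist a.1 c.1 ^ 2 + ((c.2 : ℝ) - a.2 * Real.cosh ε) ^ 2
      = (a.2 * Real.sinh ε) ^ 2} := measurableSet_eq_fun (by fun_prop) (by fun_prop)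
  rw [heq, intensity, Measure.prod_apply_symm hm]
  refine (lintegral_congr fun z => ?_).trans lintegral_zero
  refine measure_mono_null (t := Metric.sphere a.1
    √((a.2 * Real.sinh ε) ^ 2 - ((z : ℝ) - a.2 * Real.cosh ε) ^ 2)) (fun x hx => ?_) ?_
  · have hx' : dist a.1 x ^ 2 + ((z : ℝ) - a.2 * Real.cosh ε) ^ 2 = (a.2 * Real.sinh ε) ^ 2 := hx
    rw [Metric.mem_sphere, ← hx', add_sub_cancel_right, Real.sqrt_sq dist_nonneg, dist_comm]
  · rw [Measure.smul_apply, Measure.addHaar_sphere, smul_zero]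

theorem intensity_blockers {f : ℝ → ℝ} (h1 : ∫⁻ z in Ioi (0 : ℝ), ENNReal.ofReal (f z) = 1)
    {lam : ℝ} (h0 : ∀ a, intensity lam f {a} = 0) (a b : H3) :
    intensity lam f (blockers a b) = intensity lam f (unionBalls a b) := by
  have hR := dH_nonneg a b
  rw [unionBalls, ← hypBall_eq_eucBall hR, ← hypBall_eq_eucBall hR]
  refine measure_congr ?_
  filter_upwards [compl_mem_ae_iff.2 (h0 a), compl_mem_ae_iff.2 (h0 b),
    compl_mem_ae_iff.2 (intensity_sphere h1 lam hR a),
    compl_mem_ae_iff.2 (intensity_sphere h1 lam hR b)] with c hca hcb hsa hsb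
  have ea : dH a c ≤ dH a b ↔ dH a c < dH a b := ⟨fun h => lt_of_le_of_ne h hsa, le_of_lt⟩
  have eb : dH b c ≤ dH a b ↔ dH b c < dH a b := ⟨fun h => lt_of_le_of_ne h hsb, le_of_lt⟩
  refine propext ⟨fun h => ?_, fun h => ⟨hca, hcb, ?_⟩⟩
  · exact h.2.2.imp ea.1 eb.1
  · exact h.imp ea.2 eb.2

theorem measurableSet_mnnr (D : Set (ℝ × ℝ)) {a b : H3} (hab : a ≠ b) :
    MeasurableSet {φ : Config | MNNR φ.1 D a b} := by
  simp only [mnnr_iff hab, ← encard_eq_zero]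
  refine (MeasurableSet.const _).inter (.inter ?_ (.inter ?_ ?_))
  · exact measurable_prodMk_left Config.measurableSet_mem
  · exact measurable_prodMk_left Config.measurableSet_mem
  · exact Config.measurable_encard (measurableSet_blockers a b) (t := {0}) .of_discrete

/-- The Palm probability of the relation is the probability that `Φ` has no blockers. -/
theorem palm_mnnr {Ω : Type*} [MeasurableSpace Ω] {P : Measure Ω} [IsProbabilityMeasure P]
    {lam : ℝ} (hlam : 0 < lam) {f : ℝ → ℝ} (hf : Measurable f) (hf0 : ∀ z, 0 < z → 0 ≤ f z)
    (h1 : ∫⁻ z in Ioi (0 : ℝ), ENNReal.ofReal (f z) = 1) (D : Set (ℝ × ℝ)) {Φ : Ω → Config}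
    (h : IsSlabPoisson P (intensity lam f) Φ) {a b : H3} (hab : a ≠ b) :
    P.map (fun ω => (Φ ω).addPair a b) {φ | MNNR φ.1 D a b} =
      ENNReal.ofReal (pairProb lam f D a b) := by
  obtain ⟨-, hF, hΛ⟩ := pairF_spec hf hf0 h1 hlam hab
  rw [Measure.map_apply (h.measurable_addPair a b) (measurableSet_mnnr D hab), pairProb]
  by_cases hD : ((a.2 : ℝ), (b.2 : ℝ)) ∈ D
  · have hset : (fun ω => (Φ ω).addPair a b) ⁻¹' {φ | MNNR φ.1 D a b} =
        {ω | ∀ _ : Unit, ((Φ ω).1 ∩ blockers a b).encard = (0 : ℕ)} := by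
      ext ω
      have hQ : ((Φ ω).addPair a b).1 ∩ blockers a b = (Φ ω).1 ∩ blockers a b := by
        refine Subset.antisymm ?_ (inter_subset_inter_left _ fun x hx => Or.inr (Or.inr hx))
        rintro c ⟨rfl | rfl | hc, hcQ⟩
        · exact absurd rfl hcQ.1
        · exact absurd rfl hcQ.2.1
        · exact ⟨hc, hcQ⟩
      simp only [mem_preimage, mem_ofPred_eq, mnnr_iff hab, hQ, hD, true_and, forall_const,
        Nat.cast_zero, encard_eq_zero]
      exact ⟨fun h => h.2.2, fun h => ⟨Or.inl rfl, Or.inr (Or.inl rfl), h⟩⟩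
    obtain ⟨m, hm⟩ := exists_blockers_subset_slab a b
    rw [hset, h.count_law Unit (fun _ => blockers a b) m (fun _ => measurableSet_blockers a b)
      (fun _ => hm) (fun i j hij => absurd (Subsingleton.elim i j) hij) fun _ => 0]
    rw [Finset.univ_unique, Finset.prod_singleton, intensity_blockers h1 h.singleton_eq_zero, hΛ,
      poissonMeasure_singleton, indicator_of_mem hD]
    have hr : 0 ≤ lam * pairF f (dE a b) a.2 b.2 := mul_nonneg hlam.le hF
    congr 1
    simp only [pow_zero, Nat.factorial_zero, Nat.cast_one, div_one, mul_one]
    exact congrArg (fun x => Real.exp (-x)) (ENNReal.toReal_ofReal hr)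
  · have hset : (fun ω => (Φ ω).addPair a b) ⁻¹' {φ | MNNR φ.1 D a b} = ∅ :=
      eq_empty_of_forall_notMem fun ω hω => hD hω.2.2
    rw [hset, measure_empty, indicator_of_notMem hD, mul_zero, ENNReal.ofReal_zero]

end HypMNNR

theorem theorem1 {Ω : Type*} [MeasurableSpace Ω] (P : Measure Ω) [IsProbabilityMeasure P]
    (lam : ℝ) (hlam : 0 < lam)
    (f : ℝ → ℝ) (hf_meas : Measurable f) (hf_nonneg : ∀ z, 0 < z → 0 ≤ f z)
    (hf_one : ∫⁻ z in Ioi (0 : ℝ), ENNReal.ofReal (f z) = 1)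
    (D : Set (ℝ × ℝ)) (hD_meas : MeasurableSet D) (hD_sub : D ⊆ Ioi 0 ×ˢ Ioi 0)
    (hD_symm : ∀ z t : ℝ, (z, t) ∈ D → (t, z) ∈ D)
    (Φ : Ω → HypMNNR.Config) (hΦ_meas : Measurable Φ)
    (hΦ : HypMNNR.IsMarkedPPP P lam f Φ) :
    -- the function `F`: its integrals converge, it is nonnegative, and `lam * F` is the
    -- `Λ`-measure of the union of the two Euclidean balls representing the hyperbolic balls
    (∀ a b : HypMNNR.H3, a ≠ b →
      HypMNNR.PairFConverges f (HypMNNR.dE a b) a.2 b.2 ∧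
      0 ≤ HypMNNR.pairF f (HypMNNR.dE a b) a.2 b.2 ∧
      HypMNNR.hypBall (HypMNNR.dH a b) a = HypMNNR.eucBall (HypMNNR.dH a b) a ∧
      HypMNNR.hypBall (HypMNNR.dH a b) b = HypMNNR.eucBall (HypMNNR.dH a b) b ∧
      HypMNNR.intensity lam f (HypMNNR.unionBalls a b) =
        ENNReal.ofReal (lam * HypMNNR.pairF f (HypMNNR.dE a b) a.2 b.2)) ∧
    -- the law of `Φ` with `a` and `b` added is a version of the two-fold Palm measure, and for it
    -- the formula holds for all `a ≠ b`
    (∃ κ : Kernel (HypMNNR.H3 × HypMNNR.H3) HypMNNR.Config,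
      HypMNNR.IsTwoFoldPalm P Φ κ ∧
      (∀ a b : HypMNNR.H3, κ (a, b) = P.map fun ω => (Φ ω).addPair a b) ∧
      ∀ a b : HypMNNR.H3, a ≠ b →
        κ (a, b) {φ | HypMNNR.MNNR φ.1 D a b} =
          ENNReal.ofReal (HypMNNR.pairProb lam f D a b)) ∧
    -- for every version of the two-fold Palm measure the formula holds for almost all `(a, b)`
    (∀ κ : Kernel (HypMNNR.H3 × HypMNNR.H3) HypMNNR.Config,
      HypMNNR.IsTwoFoldPalm P Φ κ →
      ∀ᵐ p ∂(HypMNNR.intensity lam f).prod (HypMNNR.intensity lam f),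
        κ p {φ | HypMNNR.MNNR φ.1 D p.1 p.2} =
          ENNReal.ofReal (HypMNNR.pairProb lam f D p.1 p.2)) := by
  have h := HypMNNR.isSlabPoisson_of_isMarkedPPP hf_one hΦ_meas hΦ
  have := h.sigmaFinite
  have hpalm : ∀ a b : HypMNNR.H3, a ≠ b → h.palm (a, b) {φ | HypMNNR.MNNR φ.1 D a b} =
      ENNReal.ofReal (HypMNNR.pairProb lam f D a b) := fun a b hab =>
    HypMNNR.palm_mnnr hlam hf_meas hf_nonneg hf_one D h hab
  refine ⟨fun a b hab => ?_, ⟨h.palm, h.isTwoFoldPalm_palm, fun a b => rfl, hpalm⟩,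
    fun κ hκ => ?_⟩
  · obtain ⟨hc, hF, hΛ⟩ := HypMNNR.pairF_spec hf_meas hf_nonneg hf_one hlam hab
    exact ⟨hc, hF, HypMNNR.hypBall_eq_eucBall (HypMNNR.dH_nonneg a b) a,
      HypMNNR.hypBall_eq_eucBall (HypMNNR.dH_nonneg a b) b, hΛ⟩
  · filter_upwards [h.ae_eq_palm hκ, h.ae_ne] with p hp hne
    rw [hp]
    exact hpalm p.1 p.2 hne
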